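/- **Decision trees.** A deterministic decision tree $B$ on $n$ Boolean variables is a binary tree whose internal nodes are labelled by variables (with one outgoing edge for each value) and whose leaves are labelled by $0$ or $1$. $B(x)$ is the label of the leaf reached on input $x$, and $L_B(x)$ is the set of variables queried on $x$. A randomized decision tree $A$ is a probability distribution over deterministic ones; it computes $f:\{0,1\}^n\to\{0,1\}$ with error at most $\delta$ if $\Pr_{B\sim A}[B(x)\ne f(x)]\le\delta$ for every $x\in\{0,1\}^n$. Let $\mathcal P_f^\delta$ be the set of such $A$, and $$R_\delta(f)=\min_{A\in\mathcal P_f^\delta}\max_{x}\mathbb E_{B\sim A}|L_B(x)| .$$ **Recursive majority and hard inputs.** $\text{3-MAJ}_h$ is the function of $3^h$ bits, placed at the leaves of the complete ternary tree of height $h$, in which every internal node computes the majority of its three children ($\text{3-MAJ}_0$ is the identity). $\mathcal H_h\subseteq\{0,1\}^{3^h}$ is the set of inputs for which at every internal node the values of the three children are not all equal, and $\mathcal H_h^0=\{x\in\mathcal H_h:\text{3-MAJ}_h(x)=0\}$. For $x\in\mathcal H_h$, the absolute minority $m(x)$ is the leaf reached from the root by always moving to the child whose value differs from that of its parent. Let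 $$p_h^\delta=\min_{A\in\mathcal P^\delta_{\text{3-MAJ}_h}}\ \Pr_{x\in\mathcal H_h,\;B\sim A}[\,m(x)\in L_B(x)\,],$$ where $x$ is uniform in $\mathcal H_h$. **The uniform encoding.** For bits $y,b$ let $c(y,(b,1))=y\,b\,(1-b)$, $c(y,(b,2))=(1-b)\,y\,b$ and $c(y,(b,3))=b\,(1-b)\,y$. The one-level encoding replaces each bit $y_i$ of an input of height $h$ by the three bits $c(y_i,r_i)$ with $r_i\in\{0,1\}\times\{1,2,3\}$, giving an input of height $h+1$. The uniform $k$-level encoding $\psi(y,r)\in\mathcal H_k$ of a single bit $y$ is obtained by $k$ successive one-level encodings; here $r$ consists of one element of $\{0,1\}\times\{1,2,3\}$ for each internal node of the ternary tree of height $k$. For each $r$ there is a unique position $q(r)$ such that $\psi(y,r)_{q(r)}=y$ for both bits $y$. For $k\ge1$ and a deterministic decision tree $C$ on $3^k$ variables that queries at least one variable, let $$\alpha_C=\frac{\Pr_{x\in\mathcal H_k^0,\;(y,r)\in\psi^{-1}(x)}[\,q(r)\in L_C(x)\,]}{\Pr_{x\in\mathcal H_k^0}[\,m(x)\in L_C(x)\,]},\qquad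 \alpha_k=\max_C\alpha_C ,$$ where $x$ is uniform in $\mathcal H_k^0$, $(y,r)$ is then uniform in $\psi^{-1}(x)$, and the maximum is over all such $C$. **Theorem.** For all integers $k\ge1$, $h\ge0$ and every real $\delta\ge0$, $$p_h^\delta\ \ge\ (1-2\delta)\,\frac{\alpha_k}{2^k}\,\alpha_k^{-h/k},$$ and consequently $$R_\delta(\text{3-MAJ}_h)\ \ge\ (1-2\delta)\,\frac{\alpha_k}{2^k}\left(2+\alpha_k^{-1/k}\right)^h .$$ -/

import Mathlib

open scoped BigOperators

namespace RecMaj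

/-! ## Decision trees -/

/-- Deterministic decision trees on Boolean variables indexed by `ι`: leaves carry an output bit,
an internal node carries a variable and two subtrees (for the answers `false` and `true`). -/
inductive DecTree (ι : Type) : Type
  | leaf (b : Bool) : DecTree ι
  | node (i : ι) (t₀ t₁ : DecTree ι) : DecTree ι

namespace DecTree

variable {ι : Type}

/-- The output of the tree on the input `x`. -/
def eval : DecTree ι → (ι → Bool) → Bool
  | leaf b, _ => b
  | node i t₀ t₁, x => if x i then t₁.eval x else t₀.eval x

/-- The set of variables queried by the tree on the input `x`. -/
def queried [DecidableEq ι] : DecTree ι → (ι → Bool) → Finset ι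
  | leaf _, _ => ∅
  | node i t₀ t₁, x => insert i (if x i then t₁.queried x else t₀.queried x)

/-- The tree queries at least one variable. -/
def QueriesSomething [DecidableEq ι] (C : DecTree ι) : Prop :=
  ∃ x : ι → Bool, (C.queried x).Nonempty

end DecTree

/-- A randomized decision tree: a probability distribution over deterministic ones. -/
abbrev RandTree (ι : Type) : Type := PMF (DecTree ι)

namespace RandTree

variable {ι : Type}

/-- The expectation of `g B` for a deterministic tree `B` sampled from `A`. -/
noncomputable def expect (A : RandTree ι) (g : DecTree ι → ℝ) : ℝ :=
  ∑' B, (A B).toReal * g B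

open Classical in
/-- The probability of the event `P B` for a deterministic tree `B` sampled from `A`. -/
noncomputable def prob (A : RandTree ι) (P : DecTree ι → Prop) : ℝ :=
  A.expect fun B => if P B then 1 else 0

/-- `A` computes `f` with two-sided error at most `δ` on every input. -/
def Computes (A : RandTree ι) (f : (ι → Bool) → Bool) (δ : ℝ) : Prop :=
  ∀ x, A.prob (fun B => B.eval x ≠ f x) ≤ δ

/-- The expected number of input bits queried by `A` on the input `x`. -/
noncomputable def cost [DecidableEq ι] (A : RandTree ι) (x : ι → Bool) : ℝ :=
  A.expect fun B => ((B.queried x).card : ℝ)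

end RandTree

/-- The `δ`-error randomized decision tree complexity of `f`. -/
noncomputable def randComplexity {ι : Type} [Fintype ι] [DecidableEq ι]
    (δ : ℝ) (f : (ι → Bool) → Bool) : ℝ :=
  sInf {c : ℝ | ∃ A : RandTree ι, A.Computes f δ ∧ c = ⨆ x, A.cost x}

/-! ## Recursive majority and hard inputs -/

/-- The `3 ^ h` leaves of the complete ternary tree of height `h`; a leaf is given by the path
that leads to it from the root (the root's child comes first). -/
abbrev Leaf (h : ℕ) : Type := Fin h → Fin 3

/-- Inputs of height `h`. -/
abbrev Input (h : ℕ) : Type := Leaf h → Bool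

/-- The part of the input below the `a`-th child of the root. -/
def sub {h : ℕ} (x : Input (h + 1)) (a : Fin 3) : Input h :=
  fun p => x (Fin.cons a p)

/-- The majority of three bits. -/
def maj (u v w : Bool) : Bool := (u && v) || (u && w) || (v && w)

/-- The recursive majority function `3-MAJ_h`. -/
def maj3 : (h : ℕ) → Input h → Bool
  | 0, x => x Fin.elim0
  | h + 1, x => maj (maj3 h (sub x 0)) (maj3 h (sub x 1)) (maj3 h (sub x 2))

/-- Hard inputs: at every internal node the values of the three children are not all equal. -/
def IsHard : (h : ℕ) → Input h → Prop
  | 0, _ => True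
  | h + 1, x => (∀ a, IsHard h (sub x a)) ∧ ¬ ∀ a b, maj3 h (sub x a) = maj3 h (sub x b)

instance decidableIsHard : (h : ℕ) → (x : Input h) → Decidable (IsHard h x)
  | 0, _ => isTrue trivial
  | h + 1, x =>
    have : ∀ a, Decidable (IsHard h (sub x a)) := fun a => decidableIsHard h (sub x a)
    inferInstanceAs (Decidable
      ((∀ a, IsHard h (sub x a)) ∧ ¬ ∀ a b, maj3 h (sub x a) = maj3 h (sub x b)))

/-- The set of hard inputs of height `h`. -/
def hard (h : ℕ) : Finset (Input h) := Finset.univ.filter fun x => IsHard h x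

/-- The set of `0`-hard inputs of height `h`. -/
def hard₀ (h : ℕ) : Finset (Input h) := (hard h).filter fun x => maj3 h x = false

/-- The child of the root whose value disagrees with the root. If the three children have values
that are not all equal, then exactly one child disagrees with the root, and this is it. -/
def minorityChild {h : ℕ} (x : Input (h + 1)) : Fin 3 :=
  if maj3 h (sub x 0) ≠ maj3 (h + 1) x then 0
  else if maj3 h (sub x 1) ≠ maj3 (h + 1) x then 1
  else 2

/-- The absolute minority `m(x)`: the leaf reached from the root by always moving to the child
whose value disagrees with its parent. -/
def absMinority : (h : ℕ) → Input h → Leaf h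
  | 0, _ => Fin.elim0
  | h + 1, x => Fin.cons (minorityChild x) (absMinority h (sub x (minorityChild x)))

/-- The probability that `A` queries the absolute minority of a uniformly random hard input. -/
noncomputable def queryMinorityProb {h : ℕ} (A : RandTree (Leaf h)) : ℝ :=
  𝔼 x ∈ hard h, A.prob fun B => absMinority h x ∈ B.queried x

/-- `p_h^δ`: the minimal probability with which a randomized decision tree computing `3-MAJ_h`
with error at most `δ` queries the absolute minority of a uniformly random hard input. -/
noncomputable def minQueryProb (δ : ℝ) (h : ℕ) : ℝ :=
  sInf {p : ℝ | ∃ A : RandTree (Leaf h), A.Computes (maj3 h) δ ∧ p = queryMinorityProb A}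

/-! ## The uniform encoding -/

/-- The randomness used to encode one bit: a bit and a position among three. -/
abbrev Rnd : Type := Bool × Fin 3

/-- The encoding of one bit `y` by three bits: `c(y,(b,s))` has `y` at position `s`, and `b`, `1-b`
at the two cyclically following positions. -/
def enc (y : Bool) (r : Rnd) (a : Fin 3) : Bool :=
  if a = r.2 then y else if a = r.2 + 1 then r.1 else !r.1

/-- One-level encoding of an input of height `h`: the bit `y i` is replaced by the three bits
`enc (y i) (r i)`, placed at the children of `i`. -/
def encode₁ {h : ℕ} (y : Input h) (r : Leaf h → Rnd) : Input (h + 1) :=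
  fun p => enc (y (Fin.init p)) (r (Fin.init p)) (p (Fin.last h))

/-- The randomness of the `k`-level encoding of a single bit: one element of `Rnd` for every node
at depth less than `k`. -/
abbrev Rand (k : ℕ) : Type := (d : Fin k) → Leaf d → Rnd

/-- The uniform `k`-level encoding of a single bit `y` (an input of height `0`) by an input of
height `k`: one-level encodings are applied `k` times in succession, with independent randomness
for the levels. -/
def encode : (k : ℕ) → Bool → Rand k → Input k
  | 0, y, _ => fun _ => y
  | k + 1, y, r => encode₁ (encode k y fun d => r d.castSucc) (r (Fin.last k))

/-- The position at which the `k`-level encoding with randomness `r` places the encoded bit. -/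
def hidden : (k : ℕ) → Rand k → Leaf k
  | 0, _ => Fin.elim0
  | k + 1, r =>
    Fin.snoc (α := fun _ => Fin 3) (hidden k fun d => r d.castSucc)
      (r (Fin.last k) (hidden k fun d => r d.castSucc)).2

/-- `hidden k r` is the unique position whose bit is the encoded bit, whatever that bit is. -/
theorem hidden_iff (k : ℕ) (r : Rand k) (i : Leaf k) :
    (∀ y, encode k y r i = y) ↔ i = hidden k r := by
  induction k with
  | zero => exact ⟨fun _ => Subsingleton.elim _ _, fun _ _ => rfl⟩
  | succ k ih =>
    have hi := ih (fun d => r d.castSucc) (Fin.init i)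
    constructor
    · intro H
      have hl : i (Fin.last k) = (r (Fin.last k) (Fin.init i)).2 := by
        by_contra hne
        have h0 := H false
        have h1 := H true
        simp only [encode, encode₁, enc, if_neg hne] at h0 h1
        rw [h0] at h1
        exact absurd h1 (by decide)
      have hp : Fin.init i = hidden k fun d => r d.castSucc := by
        rw [← hi]
        intro y
        have hy := H y
        simpa only [encode, encode₁, enc, if_pos hl] using hy
      rw [hp] at hl
      have hs : Fin.snoc (α := fun _ => Fin 3) (Fin.init i) (i (Fin.last k)) = i :=
        Fin.snoc_init_self i
      rw [← hs, hl, hp]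
      rfl
    · rintro rfl y
      have e1 : Fin.init (hidden (k + 1) r) = hidden k fun d => r d.castSucc :=
        Fin.init_snoc (α := fun _ => Fin 3) _ _
      have e2 : hidden (k + 1) r (Fin.last k) =
          (r (Fin.last k) (hidden k fun d => r d.castSucc)).2 :=
        Fin.snoc_last (α := fun _ => Fin 3) _ _
      rw [e1] at hi
      simp only [encode, encode₁, enc, e1, e2, if_true]
      exact hi.2 rfl y

/-- The set of pairs of a bit and a randomness that encode to `x`. -/
def fiber (k : ℕ) (x : Input k) : Finset (Bool × Rand k) :=
  Finset.univ.filter fun yr => encode k yr.1 yr.2 = x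

/-- The probability that `C` queries the position of the encoded bit, for a uniformly random
`0`-hard input `x` and a uniformly random preimage of `x` under the encoding. -/
noncomputable def queryHiddenProb {k : ℕ} (C : DecTree (Leaf k)) : ℝ :=
  𝔼 x ∈ hard₀ k, 𝔼 yr ∈ fiber k x, if hidden k yr.2 ∈ C.queried x then (1 : ℝ) else 0

/-- The probability that `C` queries the absolute minority of a uniformly random `0`-hard input. -/
noncomputable def queryMinorityProb₀ {k : ℕ} (C : DecTree (Leaf k)) : ℝ :=
  𝔼 x ∈ hard₀ k, if absMinority k x ∈ C.queried x then (1 : ℝ) else 0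

/-- The ratio `α_C`. -/
noncomputable def ratio {k : ℕ} (C : DecTree (Leaf k)) : ℝ :=
  queryHiddenProb C / queryMinorityProb₀ C

/-- The values `α_C` for the decision trees `C` on `3 ^ k` variables that query at least one
variable. -/
def ratios (k : ℕ) : Set ℝ := {a | ∃ C : DecTree (Leaf k), C.QueriesSomething ∧ a = ratio C}

/-- `α_k`: the maximum of `α_C`. -/
noncomputable def alpha (k : ℕ) : ℝ := sSup (ratios k)

/-- The supremum that defines `alpha` is a maximum. -/
theorem alpha_isGreatest (k : ℕ) : IsGreatest (ratios k) (alpha k) := by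
  have hfin : (ratios k).Finite := by
    let F : (Input k → Finset (Leaf k)) → ℝ := fun q =>
      (𝔼 x ∈ hard₀ k, 𝔼 yr ∈ fiber k x, if hidden k yr.2 ∈ q x then (1 : ℝ) else 0) /
        𝔼 x ∈ hard₀ k, if absMinority k x ∈ q x then (1 : ℝ) else 0
    refine (Set.finite_range F).subset ?_
    rintro a ⟨C, -, rfl⟩
    exact ⟨C.queried, rfl⟩
  have hne : (ratios k).Nonempty :=
    ⟨_, .node (fun _ => 0) (.leaf false) (.leaf false),
      ⟨fun _ => false, ⟨fun _ => 0, by simp [DecTree.queried]⟩⟩, rfl⟩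
  exact ⟨hne.csSup_mem hfin, fun a ha => le_csSup hfin.bddAbove ha⟩

end RecMaj

/-! The engine is a randomized substitution, a "code", from inputs of height `m` to inputs of height
`n`. It preserves the recursive majority and carries uniform hard inputs of each value to uniform
hard inputs of the same value (`IsCode`). Substituting a code into an algorithm for height `n` gives
algorithms for height `m` with the same error. If, on average, the probability of querying the
absolute minority grows by a factor at most `c` (`Dominates`), then `p_m ≤ c * p_n`
(`minQueryProb_le_mul`).

Codes lift: given the values of the root's children, the three parts are independent uniform hard
inputs, and once the siblings are fixed the tree restricted to one child is an ordinary
deterministic tree there. So an inequality for `f` holds for `f` applied independently below each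
child (`IsCode.lift`, `Dominates.lift`). Lifting the `k`-level encoding of one bit `h` times gives
`p_h ≤ α_k * p_(h+k)` (`exists_code_add`). A case analysis on three variables, lifted in the same
way, gives `p_h ≤ 2 * p_(h+1)` and `α_k ≤ 2^k` (`dominates_bottomCode`, `alpha_le_two_pow`). With
`p_0 ≥ 1 - 2δ`, these yield the first bound: the factor 2 handles heights below `k`, and steps of
`k` levels handle the rest (`minQueryProb_lower_bound`).

For the number of queries, let `J(t, n)` be the expected number of queried leaves reached by `t`
free steps followed by minority steps. Freeing one more step adds the two majority children at depth
`t`; a code that hides a shorter input at a random one of them gives `J(t+1, n+1) ≥ J(t, n+1) + 2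
J(t, n)`, where the last term is averaged over the substituted algorithms (`exists_code_count`). If
`p_s ≥ c a^s` for all `s`, induction gives `J(t, s+t) ≥ c a^s (2+a)^t`; at `s = 0` the left side is
the expected total number of queries. -/

namespace RecMaj

open Finset

/-! ## Averages -/

open Classical in
/-- The indicator of a proposition, as a real number. -/
noncomputable def ind (p : Prop) : ℝ := if p then 1 else 0

theorem ite_eq_ind (p : Prop) [Decidable p] : (if p then (1 : ℝ) else 0) = ind p := by
  unfold ind; congr

theorem ind_nonneg (p : Prop) : 0 ≤ ind p := by
  unfold ind; split_ifs <;> norm_num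

theorem ind_le_one (p : Prop) : ind p ≤ 1 := by
  unfold ind; split_ifs <;> norm_num

theorem ind_true {p : Prop} (h : p) : ind p = 1 := if_pos h

theorem ind_false {p : Prop} (h : ¬ p) : ind p = 0 := if_neg h

theorem ind_congr {p q : Prop} (h : p ↔ q) : ind p = ind q := by rw [propext h]

/-- The map `φ` pushes the uniform distribution on `s` to the uniform distribution on `t`. -/
def Pushes {α β : Type*} (s : Finset α) (t : Finset β) (φ : α → β) : Prop :=
  ∀ g : β → ℝ, 𝔼 a ∈ s, g (φ a) = 𝔼 b ∈ t, g b

section Pi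

variable {ι α β : Type*} [Fintype ι] [DecidableEq ι]

/-- Resampling one coordinate of a uniformly random point of a box. -/
theorem expect_piFinset_update (s : ι → Finset α) (a : ι) (F : (ι → α) → ℝ) :
    𝔼 z ∈ Fintype.piFinset s, 𝔼 w ∈ s a, F (Function.update z a w) =
      𝔼 z ∈ Fintype.piFinset s, F z := by
  have h : 𝔼 z ∈ Fintype.piFinset s, F z =
      𝔼 z ∈ Fintype.piFinset s, 𝔼 _w ∈ s a, F z :=
    expect_congr rfl fun z hz => (expect_const ⟨z a, Fintype.mem_piFinset.1 hz a⟩ _).symm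
  rw [h, ← expect_product', ← expect_product']
  -- Exchanging the coordinate `z a` with the fresh sample `w` is an involution of the product.
  refine expect_nbij' (fun p => (Function.update p.1 a p.2, p.1 a))
    (fun p => (Function.update p.1 a p.2, p.1 a)) ?_ ?_ ?_ ?_ ?_
  · rintro ⟨z, w⟩ hzw
    simp only [mem_product, Fintype.mem_piFinset] at hzw ⊢
    refine ⟨fun c => ?_, hzw.1 a⟩
    by_cases hc : c = a
    · subst hc; simpa using hzw.2
    · simpa [Function.update_of_ne hc] using hzw.1 c
  · rintro ⟨z, w⟩ hzw
    simp only [mem_product, Fintype.mem_piFinset] at hzw ⊢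
    refine ⟨fun c => ?_, hzw.1 a⟩
    by_cases hc : c = a
    · subst hc; simpa using hzw.2
    · simpa [Function.update_of_ne hc] using hzw.1 c
  · rintro ⟨z, w⟩ -; simp
  · rintro ⟨z, w⟩ -; simp
  · rintro ⟨z, w⟩ -; simp

theorem expect_piFinset_prod (s : ι → Finset α) (g : ι → α → ℝ) :
    𝔼 z ∈ Fintype.piFinset s, ∏ c, g c (z c) = ∏ c, 𝔼 w ∈ s c, g c w := by
  simp only [expect_eq_sum_div_card, prod_div_distrib, Fintype.card_piFinset, Nat.cast_prod,
    Finset.prod_univ_sum]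

/-- Any `G` is a linear combination of point indicators, and these are products over the
coordinates, so their averages factor. -/
theorem pushes_piFinset [Fintype β] [DecidableEq β] {s : ι → Finset α} {t : ι → Finset β}
    {φ : ι → α → β} (h : ∀ c, Pushes (s c) (t c) (φ c)) :
    Pushes (Fintype.piFinset s) (Fintype.piFinset t) (fun z c => φ c (z c)) := by
  intro G
  have key (u : ι → β) : G u = ∑ x : ι → β, G x * ∏ c, ind (u c = x c) := by
    rw [sum_eq_single u]
    · simp [ind_true]
    · intro x _ hx
      obtain ⟨c, hc⟩ := Function.ne_iff.1 hx
      rw [prod_eq_zero (mem_univ c) (ind_false (Ne.symm hc)), mul_zero]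
    · simp
  rw [expect_congr rfl fun z _ => key _, expect_congr (t := Fintype.piFinset t) rfl fun z _ => key z,
    expect_sum_comm, expect_sum_comm]
  refine sum_congr rfl fun x _ => ?_
  rw [← mul_expect, ← mul_expect, expect_piFinset_prod s fun c w => ind (φ c w = x c),
    expect_piFinset_prod t fun c w => ind (w = x c)]
  exact congrArg _ (prod_congr rfl fun c _ => h c fun w => ind (w = x c))

end Pi

/-! ## Substitution into decision trees -/

namespace DecTree

variable {ι κ : Type}

/-- The input obtained from `y` by the substitution `f`, which replaces each variable by another
variable or by a constant. -/
def app (f : ι → κ ⊕ Bool) (y : κ → Bool) : ι → Bool := fun i => Sum.elim y id (f i)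

/-- The decision tree that runs `B` on the input `app f y`. -/
def subst (f : ι → κ ⊕ Bool) : DecTree ι → DecTree κ
  | leaf b => leaf b
  | node i t₀ t₁ =>
    match f i with
    | .inl j => node j (t₀.subst f) (t₁.subst f)
    | .inr b => if b then t₁.subst f else t₀.subst f

theorem eval_subst (f : ι → κ ⊕ Bool) (B : DecTree ι) (y : κ → Bool) :
    (B.subst f).eval y = B.eval (app f y) := by
  induction B with
  | leaf b => rfl
  | node i t₀ t₁ h₀ h₁ =>
    rcases hf : f i with j | b
    · simp [subst, eval, hf, h₀, h₁, app]
    · cases b <;> simp [subst, eval, hf, h₀, h₁, app]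

theorem mem_queried_subst [DecidableEq ι] [DecidableEq κ] (f : ι → κ ⊕ Bool) (B : DecTree ι)
    (y : κ → Bool) (j : κ) :
    j ∈ (B.subst f).queried y ↔ ∃ i ∈ B.queried (app f y), f i = .inl j := by
  induction B with
  | leaf b => simp [subst, queried]
  | node i t₀ t₁ h₀ h₁ =>
    have ha : app f y i = Sum.elim y id (f i) := rfl
    rcases hf : f i with j' | b
    · cases hy : y j' <;>
        simp [subst, queried, hf, h₀, h₁, ha, hy, eq_comm]
    · cases b <;> simp [subst, queried, hf, h₀, h₁, ha]

theorem subst_subst {μ : Type} (f : ι → κ ⊕ Bool) (g : κ → μ ⊕ Bool) (B : DecTree ι) :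
    (B.subst f).subst g = B.subst (fun i => Sum.elim g Sum.inr (f i)) := by
  induction B with
  | leaf b => rfl
  | node i t₀ t₁ h₀ h₁ =>
    rcases hf : f i with j | b
    · rcases hg : g j with k | b
      · simp [subst, hf, hg, h₀, h₁]
      · cases b <;> simp [subst, hf, hg, h₀, h₁]
    · cases b <;> simp [subst, hf, h₀, h₁]

/-- The decision tree that runs `B` on the complement of its input. -/
def flip : DecTree ι → DecTree ι
  | leaf b => leaf b
  | node i t₀ t₁ => node i t₁.flip t₀.flip

theorem queried_flip [DecidableEq ι] (B : DecTree ι) (x : ι → Bool) :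
    B.flip.queried x = B.queried fun i => !x i := by
  induction B with
  | leaf b => rfl
  | node i t₀ t₁ h₀ h₁ => cases hx : x i <;> simp [flip, queried, h₀, h₁, hx]

/-- Every Boolean function is computed by a decision tree that always queries all variables. -/
theorem exists_eval_eq [Fintype ι] [DecidableEq ι] (f : (ι → Bool) → Bool) :
    ∃ B : DecTree ι, B.eval = f ∧ ∀ x, B.queried x = univ := by
  suffices h : ∀ (S : Finset ι) (f : (ι → Bool) → Bool),
      (∀ x x', (∀ i ∈ S, x i = x' i) → f x = f x') →
      ∃ B : DecTree ι, B.eval = f ∧ ∀ x, S ⊆ B.queried x by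
    obtain ⟨B, hB, hq⟩ := h univ f fun x x' hx => congrArg f (funext fun i => hx i (mem_univ i))
    exact ⟨B, hB, fun x => univ_subset_iff.1 (hq x)⟩
  intro S
  induction S using Finset.induction_on with
  | empty =>
    intro f hf
    exact ⟨leaf (f fun _ => false), funext fun x => hf _ _ (by simp), by simp⟩
  | insert i S hi ih =>
    intro f hf
    have hb (b : Bool) := ih (fun x => f (Function.update x i b)) fun x x' hx => hf _ _ fun j hj => by
      by_cases hji : j = i
      · subst hji; simp
      · simpa [Function.update_of_ne hji] using hx j ((mem_insert.1 hj).resolve_left hji)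
    obtain ⟨B₀, h₀, q₀⟩ := hb false
    obtain ⟨B₁, h₁, q₁⟩ := hb true
    refine ⟨node i B₀ B₁, funext fun x => ?_, fun x => ?_⟩
    · cases hx : x i
      · have : Function.update x i false = x := by rw [← hx]; exact Function.update_eq_self i x
        simp [eval, hx, h₀, this]
      · have : Function.update x i true = x := by rw [← hx]; exact Function.update_eq_self i x
        simp [eval, hx, h₁, this]
    · cases hx : x i
      · simpa [queried, hx] using insert_subset_insert i (q₀ x)
      · simpa [queried, hx] using insert_subset_insert i (q₁ x)

end DecTree

/-! ## Hard inputs of a given value -/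

/-- The input whose parts below the children of the root are given. -/
def glue {h : ℕ} (z : Fin 3 → Input h) : Input (h + 1) := fun p => z (p 0) (Fin.tail p)

theorem sub_glue {h : ℕ} (z : Fin 3 → Input h) : sub (glue z) = z := by
  funext a p; simp [sub, glue]

theorem glue_sub {h : ℕ} (x : Input (h + 1)) : glue (sub x) = x := by
  funext p; exact congrArg x (Fin.cons_self_tail p)

/-- The hard inputs of value `b`. -/
def hardOf (h : ℕ) (b : Bool) : Finset (Input h) := (hard h).filter fun x => maj3 h x = b

theorem mem_hardOf {h : ℕ} {b : Bool} {x : Input h} :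
    x ∈ hardOf h b ↔ IsHard h x ∧ maj3 h x = b := by simp [hardOf, hard]

/-- The triples of bits that are not constant and have majority `b`. -/
def patterns (b : Bool) : Finset (Fin 3 → Bool) :=
  univ.filter fun π => (¬ ∀ a c, π a = π c) ∧ maj (π 0) (π 1) (π 2) = b

theorem card_patterns (b : Bool) : #(patterns b) = 3 := by revert b; decide

theorem mem_hardOf_succ {h : ℕ} {b : Bool} {x : Input (h + 1)} :
    x ∈ hardOf (h + 1) b ↔
      (fun c => maj3 h (sub x c)) ∈ patterns b ∧ ∀ c, IsHard h (sub x c) := by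
  rw [mem_hardOf, patterns, mem_filter]
  simp only [IsHard, maj3, mem_univ, true_and]
  tauto

/-- A hard input amounts to the triple of values at the root's children together with three
independent choices of hard inputs with these values. -/
theorem sum_hardOf_succ {M : Type*} [AddCommMonoid M] (h : ℕ) (b : Bool) (g : Input (h + 1) → M) :
    ∑ x ∈ hardOf (h + 1) b, g x =
      ∑ π ∈ patterns b, ∑ z ∈ Fintype.piFinset fun c => hardOf h (π c), g (glue z) := by
  rw [sum_sigma']
  refine sum_nbij' (fun x => ⟨fun c => maj3 h (sub x c), sub x⟩) (fun p => glue p.2) ?_ ?_ ?_ ?_ ?_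
  · intro x hx
    rw [mem_hardOf_succ] at hx
    exact mem_sigma.2 ⟨hx.1, Fintype.mem_piFinset.2 fun c => mem_hardOf.2 ⟨hx.2 c, rfl⟩⟩
  · rintro ⟨π, z⟩ hp
    rw [mem_sigma, Fintype.mem_piFinset] at hp
    have hz (c) := mem_hardOf.1 (hp.2 c)
    rw [mem_hardOf_succ]
    simp only [sub_glue, hz]
    exact ⟨hp.1, fun _ => trivial⟩
  · intro x _; exact glue_sub x
  · rintro ⟨π, z⟩ hp
    rw [mem_sigma, Fintype.mem_piFinset] at hp
    have hz : (fun c => maj3 h (z c)) = π := funext fun c => (mem_hardOf.1 (hp.2 c)).2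
    simp only [sub_glue, hz]
  · intro x _; simp only [glue_sub]

/-- The count does not depend on `b`; hence all root patterns are equally likely, which is what
`expect_hardOf_succ` needs. -/
theorem exists_card_hardOf (h : ℕ) : ∃ N : ℕ, 0 < N ∧ ∀ b, #(hardOf h b) = N := by
  induction h with
  | zero =>
    refine ⟨1, one_pos, fun b => card_eq_one.2 ⟨fun _ => b, ?_⟩⟩
    ext x
    rw [mem_hardOf, mem_singleton]
    simp only [IsHard, maj3, true_and]
    constructor
    · rintro rfl; funext p; exact congrArg x (Subsingleton.elim _ _)
    · rintro rfl; rfl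
  | succ h ih =>
    obtain ⟨N, hN, hc⟩ := ih
    refine ⟨3 * N ^ 3, by positivity, fun b => ?_⟩
    rw [card_eq_sum_ones, sum_hardOf_succ]
    simp only [← card_eq_sum_ones, Fintype.card_piFinset, hc]
    simp [card_patterns]

theorem hardOf_nonempty (h : ℕ) (b : Bool) : (hardOf h b).Nonempty := by
  obtain ⟨N, hN, hc⟩ := exists_card_hardOf h
  exact card_pos.1 (by rw [hc]; exact hN)

theorem expect_hardOf_succ (h : ℕ) (b : Bool) (g : Input (h + 1) → ℝ) :
    𝔼 x ∈ hardOf (h + 1) b, g x =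
      𝔼 π ∈ patterns b, 𝔼 z ∈ Fintype.piFinset fun c => hardOf h (π c), g (glue z) := by
  obtain ⟨N, hN, hc⟩ := exists_card_hardOf h
  have hcard : (#(hardOf (h + 1) b) : ℝ) = 3 * N ^ 3 := by
    rw [card_eq_sum_ones, sum_hardOf_succ]
    simp only [← card_eq_sum_ones, Fintype.card_piFinset, hc]
    simp [card_patterns]
  simp only [expect_eq_sum_div_card, sum_hardOf_succ, hcard, Fintype.card_piFinset, hc,
    card_patterns, ← sum_div]
  simp [div_div, mul_comm]

theorem expect_hardOf_zero (b : Bool) (g : Input 0 → ℝ) :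
    𝔼 x ∈ hardOf 0 b, g x = g fun _ => b := by
  have : hardOf 0 b = {fun _ => b} := by
    ext x
    rw [mem_hardOf, mem_singleton]
    simp only [IsHard, maj3, true_and]
    constructor
    · rintro rfl; funext p; exact congrArg x (Subsingleton.elim _ _)
    · rintro rfl; rfl
  rw [this, expect_singleton]

theorem expect_hard (h : ℕ) (g : Input h → ℝ) :
    𝔼 x ∈ hard h, g x = (𝔼 x ∈ hardOf h false, g x + 𝔼 x ∈ hardOf h true, g x) / 2 := by
  obtain ⟨N, hN, hc⟩ := exists_card_hardOf h
  have hd : Disjoint (hardOf h false) (hardOf h true) := by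
    rw [disjoint_left]
    intro x h0 h1
    have := (mem_hardOf.1 h0).2.symm.trans (mem_hardOf.1 h1).2
    exact absurd this (by decide)
  have hu : hard h = hardOf h false ∪ hardOf h true := by
    ext x
    simp only [mem_union, mem_hardOf, hard, mem_filter, mem_univ, true_and]
    cases maj3 h x <;> simp
  have hN' : (N : ℝ) ≠ 0 := by positivity
  rw [hu]
  simp only [expect_eq_sum_div_card, sum_union hd, card_union_of_disjoint hd, hc]
  push_cast
  field_simp
  ring

theorem hard_nonempty (h : ℕ) : (hard h).Nonempty :=
  (hardOf_nonempty h true).mono (filter_subset _ _)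

/-- The position of the entry of a triple of bits that disagrees with the majority. -/
def minorityPos (π : Fin 3 → Bool) : Fin 3 :=
  if π 0 ≠ maj (π 0) (π 1) (π 2) then 0
  else if π 1 ≠ maj (π 0) (π 1) (π 2) then 1
  else 2

theorem minorityChild_eq {h : ℕ} (x : Input (h + 1)) :
    minorityChild x = minorityPos fun c => maj3 h (sub x c) := rfl

/-! ## Restricting a decision tree to the part below a child of the root -/

/-- The restriction of `B` to the variables below the `a`-th child of the root, where the other
variables are fixed according to `x`. -/
def restrict {h : ℕ} (x : Input (h + 1)) (a : Fin 3) (B : DecTree (Leaf (h + 1))) :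
    DecTree (Leaf h) :=
  B.subst fun l => if l 0 = a then .inl (Fin.tail l) else .inr (x l)

theorem mem_queried_restrict {h : ℕ} (x : Input (h + 1)) (a : Fin 3) (B : DecTree (Leaf (h + 1)))
    (p : Leaf h) : p ∈ (restrict x a B).queried (sub x a) ↔
      (Fin.cons a p : Leaf (h + 1)) ∈ B.queried x := by
  have ha : DecTree.app (fun l : Leaf (h + 1) => if l 0 = a then Sum.inl (Fin.tail l)
      else Sum.inr (x l)) (sub x a) = x := by
    funext l
    by_cases hl : l 0 = a
    · subst hl
      simp only [DecTree.app, if_true, Sum.elim_inl, sub]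
      exact congrArg x (Fin.cons_self_tail l)
    · simp [DecTree.app, hl]
  rw [restrict, DecTree.mem_queried_subst, ha]
  constructor
  · rintro ⟨l, hl, h⟩
    by_cases hla : l 0 = a
    · subst hla
      simp only [if_true, Sum.inl.injEq] at h
      subst h
      rwa [show (Fin.cons (l 0) (Fin.tail l) : Leaf (h + 1)) = l from Fin.cons_self_tail l]
    · simp [hla] at h
  · intro hp
    exact ⟨_, hp, by simp⟩

/-- The restriction reads only the siblings of `a`. Conditioned on them, it is a fixed deterministic
tree facing a uniform hard input. -/
theorem restrict_glue_update {h : ℕ} (z : Fin 3 → Input h) (a : Fin 3) (w : Input h)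
    (B : DecTree (Leaf (h + 1))) :
    restrict (glue (Function.update z a w)) a B = restrict (glue z) a B := by
  unfold restrict
  congr 1
  funext l
  by_cases hl : l 0 = a
  · simp [hl]
  · simp [hl, glue]

theorem absMinority_mem_restrict {h : ℕ} (x : Input (h + 1)) (B : DecTree (Leaf (h + 1))) :
    absMinority (h + 1) x ∈ B.queried x ↔
      absMinority h (sub x (minorityChild x)) ∈
        (restrict x (minorityChild x) B).queried (sub x (minorityChild x)) :=
  (mem_queried_restrict x _ B _).symm

/-! ## Codes -/

section Codes

variable {Ω : Type} [Fintype Ω] {m n : ℕ}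

/-- A randomized substitution that turns inputs of height `m` into inputs of height `n`, preserves
the value, and turns uniformly random hard inputs into uniformly random hard inputs. -/
structure IsCode (f : Ω → Leaf n → Leaf m ⊕ Bool) : Prop where
  maj3_app : ∀ ω y, maj3 n (DecTree.app (f ω) y) = maj3 m y
  expect_app : ∀ (b : Bool) (g : Input n → ℝ),
    𝔼 y ∈ hardOf m b, 𝔼 ω, g (DecTree.app (f ω) y) = 𝔼 x ∈ hardOf n b, g x

/-- On average over the code `f`, the functional `F` of the substituted decision tree and a random
hard input is at most the functional `G` of the original decision tree and a random hard input. -/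
def Dominates (f : Ω → Leaf n → Leaf m ⊕ Bool) (F : DecTree (Leaf m) → Input m → ℝ)
    (G : DecTree (Leaf n) → Input n → ℝ) : Prop :=
  ∀ (b : Bool) (B : DecTree (Leaf n)),
    𝔼 y ∈ hardOf m b, 𝔼 ω, F (B.subst (f ω)) y ≤ 𝔼 x ∈ hardOf n b, G B x

/-- The code that acts independently by `f` below each child of the root. -/
def lift {Ω : Type} (f : Ω → Leaf n → Leaf m ⊕ Bool) (ω : Fin 3 → Ω) (l : Leaf (n + 1)) :
    Leaf (m + 1) ⊕ Bool :=
  (f (ω (l 0)) (Fin.tail l)).map (Fin.cons (α := fun _ => Fin 3) (l 0)) id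

/-- The functional that sums `F` over the parts below the children of the root, with weights
that depend on the values of these children. -/
noncomputable def liftFun (w : (Fin 3 → Bool) → Fin 3 → ℝ) (F : DecTree (Leaf m) → Input m → ℝ)
    (B : DecTree (Leaf (m + 1))) (y : Input (m + 1)) : ℝ :=
  ∑ a, w (fun c => maj3 m (sub y c)) a * F (restrict y a B) (sub y a)

theorem app_lift {Ω : Type} (f : Ω → Leaf n → Leaf m ⊕ Bool) (ω : Fin 3 → Ω) (y : Input (m + 1)) :
    DecTree.app (lift f ω) y = glue fun c => DecTree.app (f (ω c)) (sub y c) := by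
  funext l
  simp only [DecTree.app, lift, glue]
  rcases f (ω (l 0)) (Fin.tail l) with p | b <;> rfl

/-- Restriction commutes with a lifted code: the siblings are frozen at their encoded values, and
only the randomness `ω a` still acts. -/
theorem restrict_subst_lift {Ω : Type} (f : Ω → Leaf n → Leaf m ⊕ Bool) (ω : Fin 3 → Ω) (y : Input (m + 1))
    (a : Fin 3) (B : DecTree (Leaf (n + 1))) :
    restrict y a (B.subst (lift f ω)) =
      (restrict (DecTree.app (lift f ω) y) a B).subst (f (ω a)) := by
  rw [restrict, restrict, DecTree.subst_subst, DecTree.subst_subst]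
  congr 1
  funext l
  by_cases hl : l 0 = a
  · subst hl
    simp only [lift, if_true, Sum.elim_inl]
    rcases f (ω (l 0)) (Fin.tail l) with p | b <;> simp
  · simp only [hl, if_false, Sum.elim_inr, app_lift, glue]
    simp only [lift, DecTree.app]
    rcases f (ω (l 0)) (Fin.tail l) with p | b <;> simp [hl, sub]

/-- Independent pairs of an input and a randomness below the three children of the root. -/
theorem expect_piFinset_prod_univ (s : Fin 3 → Finset (Input m))
    (H : (Fin 3 → Input m × Ω) → ℝ) :
    𝔼 z ∈ Fintype.piFinset s, 𝔼 ω : Fin 3 → Ω, H (fun c => (z c, ω c)) =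
      𝔼 v ∈ Fintype.piFinset fun c => s c ×ˢ (univ : Finset Ω), H v := by
  rw [← expect_product']
  refine expect_nbij' (fun p c => (p.1 c, p.2 c)) (fun v => (fun c => (v c).1, fun c => (v c).2))
    ?_ ?_ ?_ ?_ ?_
  · rintro ⟨z, ω⟩ h; simpa using h
  · intro v h; simpa using h
  · rintro ⟨z, ω⟩ _; rfl
  · intro v _; rfl
  · rintro ⟨z, ω⟩ _; rfl

theorem IsCode.pushes {f : Ω → Leaf n → Leaf m ⊕ Bool} (hf : IsCode f) (b : Bool) :
    Pushes (hardOf m b ×ˢ (univ : Finset Ω)) (hardOf n b) fun p => DecTree.app (f p.2) p.1 := by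
  intro g
  rw [expect_product, hf.expect_app]

theorem IsCode.lift {f : Ω → Leaf n → Leaf m ⊕ Bool} (hf : IsCode f) : IsCode (lift f) where
  maj3_app ω y := by
    rw [app_lift]
    simp only [maj3, sub_glue, hf.maj3_app]
  expect_app b g := by
    rw [expect_hardOf_succ, expect_hardOf_succ]
    refine expect_congr rfl fun π _ => ?_
    rw [← pushes_piFinset (fun c => hf.pushes (π c)) fun z => g (glue z),
      ← expect_piFinset_prod_univ]
    simp only [app_lift, sub_glue]

/-- Fix the root pattern and the child `a`. With the siblings and their randomness fixed, `hd`
applies to the restricted tree; as `f` is a code, the encoded siblings are distributed like siblings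
of a uniform hard input. Nonnegative weights preserve the inequality. -/
theorem Dominates.lift {f : Ω → Leaf n → Leaf m ⊕ Bool} (hf : IsCode f)
    {F : DecTree (Leaf m) → Input m → ℝ} {G : DecTree (Leaf n) → Input n → ℝ}
    (hd : Dominates f F G) {w : (Fin 3 → Bool) → Fin 3 → ℝ} (hw : ∀ π a, 0 ≤ w π a) :
    Dominates (lift f) (liftFun w F) (liftFun w G) := by
  intro b B
  rw [expect_hardOf_succ, expect_hardOf_succ]
  refine expect_le_expect fun π _ => ?_
  have hπ {k : ℕ} {z : Fin 3 → Input k} (hz : z ∈ Fintype.piFinset fun c => hardOf k (π c)) :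
      (fun c => maj3 k (z c)) = π :=
    funext fun c => (mem_hardOf.1 (Fintype.mem_piFinset.1 hz c)).2
  have hl : ∀ z ∈ Fintype.piFinset fun c => hardOf m (π c),
      𝔼 ω : Fin 3 → Ω, liftFun w F (B.subst (RecMaj.lift f ω)) (glue z) =
      ∑ a, w π a * 𝔼 ω : Fin 3 → Ω,
        F ((restrict (glue fun c => DecTree.app (f (ω c)) (z c)) a B).subst (f (ω a))) (z a) := by
    intro z hz
    simp only [mul_expect]
    rw [← expect_sum_comm]
    refine expect_congr rfl fun ω _ => ?_
    simp only [liftFun, sub_glue, hπ hz, restrict_subst_lift, app_lift]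
  have hr : ∀ z ∈ Fintype.piFinset fun c => hardOf n (π c),
      liftFun w G B (glue z) = ∑ a, w π a * G (restrict (glue z) a B) (z a) := by
    intro z hz
    simp only [liftFun, sub_glue, hπ hz]
  rw [expect_congr rfl hl, expect_congr rfl hr, expect_sum_comm, expect_sum_comm]
  refine sum_le_sum fun a _ => ?_
  rw [← mul_expect, ← mul_expect]
  refine mul_le_mul_of_nonneg_left ?_ (hw π a)
  -- Resampling the part below `a` on both sides separates the average over this part from the
  -- average over the siblings.
  rw [expect_piFinset_prod_univ (fun c => hardOf m (π c)) fun v =>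
    F ((restrict (glue fun c => DecTree.app (f (v c).2) (v c).1) a B).subst (f (v a).2)) (v a).1,
    ← expect_piFinset_update _ a,
    ← expect_piFinset_update (fun c => hardOf n (π c)) a]
  have hu (v : Fin 3 → Input m × Ω) (u : Input m × Ω) :
      restrict (glue fun c => DecTree.app (f (Function.update v a u c).2)
        (Function.update v a u c).1) a B =
      restrict (glue fun c => DecTree.app (f (v c).2) (v c).1) a B := by
    rw [← restrict_glue_update (fun c => DecTree.app (f (v c).2) (v c).1) a
      (DecTree.app (f u.2) u.1) B]
    congr 2
    funext c
    by_cases hc : c = a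
    · subst hc; simp
    · simp [hc]
  simp only [hu, Function.update_self, restrict_glue_update]
  rw [← pushes_piFinset (fun c => hf.pushes (π c)) fun z =>
    𝔼 x ∈ hardOf n (π a), G (restrict (glue z) a B) x]
  refine expect_le_expect fun v _ => ?_
  rw [expect_product]
  exact hd (π a) _

theorem IsCode.comp_equiv {Ω' : Type} [Fintype Ω'] {f : Ω → Leaf n → Leaf m ⊕ Bool}
    (hf : IsCode f) (e : Ω' ≃ Ω) : IsCode fun ω => f (e ω) where
  maj3_app ω := hf.maj3_app (e ω)
  expect_app b g := by
    rw [← hf.expect_app]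
    exact expect_congr rfl fun y _ => Fintype.expect_equiv e _ _ fun _ => rfl

theorem Dominates.comp_equiv {Ω' : Type} [Fintype Ω'] {f : Ω → Leaf n → Leaf m ⊕ Bool}
    {F : DecTree (Leaf m) → Input m → ℝ} {G : DecTree (Leaf n) → Input n → ℝ}
    (hd : Dominates f F G) (e : Ω' ≃ Ω) : Dominates (fun ω => f (e ω)) F G := by
  intro b B
  refine le_of_eq_of_le ?_ (hd b B)
  exact expect_congr rfl fun y _ => Fintype.expect_equiv e _ _ fun _ => rfl

end Codes

/-! ## The code that inserts a level at the root -/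

theorem maj_enc (v : Bool) (r : Rnd) : maj (enc v r 0) (enc v r 1) (enc v r 2) = v := by
  revert v r; decide

theorem enc_of_ne (y y' : Bool) (r : Rnd) {a : Fin 3} (h : a ≠ r.2) : enc y r a = enc y' r a := by
  simp [enc, h]

/-- The encoding of a bit by three bits, together with the position of the encoded bit: the
triple is uniform, and given the triple the position is uniform among the majority entries. -/
theorem expect_enc (b : Bool) (K : (Fin 3 → Bool) → Fin 3 → ℝ) :
    𝔼 r : Rnd, K (enc b r) r.2 = 𝔼 π ∈ patterns b, (∑ a, ind (π a = b) * K π a) / 2 := by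
  have h : ∑ r : Rnd, K (enc b r) r.2 = ∑ π ∈ patterns b, ∑ a with π a = b, K π a := by
    rw [sum_sigma']
    -- The random bit can be read off at the entry cyclically after the encoded position.
    refine sum_nbij' (fun r => ⟨enc b r, r.2⟩) (fun p => (p.1 (p.2 + 1), p.2)) ?_ ?_ ?_ ?_ ?_
    · have key : ∀ (b : Bool) (r : Rnd), enc b r ∈ patterns b ∧ enc b r r.2 = b := by decide
      intro r _
      simpa using key b r
    · simp
    · revert b; decide
    · rintro ⟨π, a⟩ h
      have key : ∀ (b : Bool) (π : Fin 3 → Bool) (a : Fin 3), π ∈ patterns b → π a = b →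
          enc b (π (a + 1), a) = π := by decide
      simp only [mem_sigma, mem_filter, mem_univ, true_and] at h
      simp only [key b π a h.1 h.2]
    · simp
  have h2 (π : Fin 3 → Bool) : ∑ a, ind (π a = b) * K π a = ∑ a with π a = b, K π a := by
    rw [sum_filter]
    refine sum_congr rfl fun a _ => ?_
    simp only [← ite_eq_ind, ite_mul, one_mul, zero_mul]
  simp only [h2, expect_eq_sum_div_card, h, card_patterns, ← sum_div]
  simp [div_div]
  norm_num

/-- The substitution that places the input `y` below a random majority child of a new root, with
random hard inputs below the other children. -/
def rootCode (s : ℕ) (ω : Rnd × (Fin 3 → Rand s)) (l : Leaf (s + 1)) : Leaf s ⊕ Bool :=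
  if l 0 = ω.1.2 then .inl (Fin.tail l)
  else .inr (encode s (enc false ω.1 (l 0)) (ω.2 (l 0)) (Fin.tail l))

/-- Any `b` is allowed, because the other entries of the triple do not depend on the encoded bit;
the `false` in `rootCode` is only a placeholder. -/
theorem app_rootCode (s : ℕ) (ω : Rnd × (Fin 3 → Rand s)) (y : Input s) (b : Bool) :
    DecTree.app (rootCode s ω) y =
      glue (Function.update (fun c => encode s (enc b ω.1 c) (ω.2 c)) ω.1.2 y) := by
  funext l
  by_cases hl : l 0 = ω.1.2
  · simp [DecTree.app, rootCode, glue, hl]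
  · simp [DecTree.app, rootCode, glue, hl, enc_of_ne false b ω.1 hl]

theorem mem_queried_subst_rootCode (s : ℕ) (ω : Rnd × (Fin 3 → Rand s)) (y : Input s)
    (B : DecTree (Leaf (s + 1))) (p : Leaf s) :
    p ∈ (B.subst (rootCode s ω)).queried y ↔
      (Fin.cons ω.1.2 p : Leaf (s + 1)) ∈ B.queried (DecTree.app (rootCode s ω) y) := by
  rw [DecTree.mem_queried_subst]
  constructor
  · rintro ⟨l, hl, h⟩
    by_cases hla : l 0 = ω.1.2
    · simp only [rootCode, hla, if_true, Sum.inl.injEq] at h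
      rw [← hla, ← h]
      rwa [show (Fin.cons (l 0) (Fin.tail l) : Leaf (s + 1)) = l from Fin.cons_self_tail l]
    · simp [rootCode, hla] at h
  · intro hp
    exact ⟨_, hp, by simp [rootCode]⟩

/-- For fixed `r` the new children are independent uniform hard inputs with values `enc b r`, and
placing `y` merely resamples one of them. By `expect_enc` the marked child is then uniform among the
two majority children. -/
theorem expect_rootCode {s : ℕ} (hs : ∀ b, Pushes univ (hardOf s b) (encode s b)) (b : Bool)
    (H : Input (s + 1) → Fin 3 → ℝ) :
    𝔼 y ∈ hardOf s b, 𝔼 ω, H (DecTree.app (rootCode s ω) y) ω.1.2 =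
      𝔼 π ∈ patterns b, 𝔼 z ∈ Fintype.piFinset fun c => hardOf s (π c),
        (∑ a, ind (π a = b) * H (glue z) a) / 2 := by
  have h1 (r : Rnd) : 𝔼 y ∈ hardOf s b, 𝔼 u : Fin 3 → Rand s,
      H (DecTree.app (rootCode s (r, u)) y) r.2 =
      𝔼 z ∈ Fintype.piFinset fun c => hardOf s (enc b r c), H (glue z) r.2 := by
    simp only [app_rootCode _ _ _ b]
    have hp := pushes_piFinset (s := fun _ : Fin 3 => (univ : Finset (Rand s)))
      (t := fun c => hardOf s (enc b r c)) fun c => hs (enc b r c)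
    rw [Fintype.piFinset_univ] at hp
    have hb : enc b r r.2 = b := by simp [enc]
    rw [expect_congr rfl fun y _ => hp fun z => H (glue (Function.update z r.2 y)) r.2,
      expect_comm]
    conv_rhs => rw [← expect_piFinset_update _ r.2]
    rw [hb]
  have h2 (y : Input s) : 𝔼 ω, H (DecTree.app (rootCode s ω) y) ω.1.2 =
      𝔼 r : Rnd, 𝔼 u : Fin 3 → Rand s, H (DecTree.app (rootCode s (r, u)) y) r.2 := by
    rw [← univ_product_univ, expect_product]
  rw [expect_congr rfl fun y _ => h2 y, expect_comm, expect_congr rfl fun r _ => h1 r,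
    expect_enc b fun π a => 𝔼 z ∈ Fintype.piFinset fun c => hardOf s (π c), H (glue z) a]
  refine expect_congr rfl fun π _ => ?_
  simp only [← expect_div, expect_sum_comm, ← mul_expect]

theorem sum_ind_pattern {b : Bool} {π : Fin 3 → Bool} (hπ : π ∈ patterns b) :
    ∑ a, ind (π a = b) = 2 := by
  have : ∀ (b : Bool) (π : Fin 3 → Bool), π ∈ patterns b → #{a | π a = b} = 2 := by decide
  simp only [← ite_eq_ind, sum_boole, this b π hπ]
  norm_num

theorem isCode_rootCode {s : ℕ} (hs : ∀ b, Pushes univ (hardOf s b) (encode s b))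
    (hm : ∀ b r, maj3 s (encode s b r) = b) : IsCode (rootCode s) where
  maj3_app ω y := by
    rw [app_rootCode s ω y (maj3 s y)]
    have (c : Fin 3) : maj3 s (Function.update
        (fun c => encode s (enc (maj3 s y) ω.1 c) (ω.2 c)) ω.1.2 y c) =
        enc (maj3 s y) ω.1 c := by
      by_cases hc : c = ω.1.2
      · subst hc; simp [enc]
      · simp [hc, hm]
    simp only [maj3, sub_glue, this, maj_enc]
  expect_app b g := by
    rw [expect_rootCode hs b fun x _ => g x, expect_hardOf_succ]
    refine expect_congr rfl fun π hπ => expect_congr rfl fun z _ => ?_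
    rw [← sum_mul, sum_ind_pattern hπ]
    ring

/-! ## The code that inserts a level at the leaves -/

/-- The substitution that realizes the one-level encoding. -/
def bottomCode (h : ℕ) (R : Leaf h → Rnd) (l : Leaf (h + 1)) : Leaf h ⊕ Bool :=
  if l (Fin.last h) = (R (Fin.init l)).2 then .inl (Fin.init l)
  else .inr (enc false (R (Fin.init l)) (l (Fin.last h)))

theorem app_bottomCode (h : ℕ) (R : Leaf h → Rnd) (y : Input h) :
    DecTree.app (bottomCode h R) y = encode₁ y R := by
  funext l
  by_cases hl : l (Fin.last h) = (R (Fin.init l)).2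
  · simp [DecTree.app, bottomCode, encode₁, enc, hl]
  · simp [DecTree.app, bottomCode, encode₁, enc, hl]

theorem mem_queried_subst_bottomCode (h : ℕ) (R : Leaf h → Rnd) (y : Input h)
    (B : DecTree (Leaf (h + 1))) (p : Leaf h) :
    p ∈ (B.subst (bottomCode h R)).queried y ↔
      (Fin.snoc p (R p).2 : Leaf (h + 1)) ∈ B.queried (encode₁ y R) := by
  rw [DecTree.mem_queried_subst, app_bottomCode]
  constructor
  · rintro ⟨l, hl, h'⟩
    by_cases hla : l (Fin.last h) = (R (Fin.init l)).2
    · simp only [bottomCode, hla, if_true, Sum.inl.injEq] at h'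
      rw [← h', ← hla]
      rwa [show (Fin.snoc (Fin.init l) (l (Fin.last h)) : Leaf (h + 1)) = l from
        Fin.snoc_init_self l]
    · simp [bottomCode, hla] at h'
  · intro hp
    refine ⟨_, hp, ?_⟩
    have e1 : Fin.init (Fin.snoc p (R p).2 : Leaf (h + 1)) = p :=
      Fin.init_snoc (α := fun _ => Fin 3) _ _
    have e2 : (Fin.snoc p (R p).2 : Leaf (h + 1)) (Fin.last h) = (R p).2 :=
      Fin.snoc_last (α := fun _ => Fin 3) _ _
    simp only [bottomCode, e1, e2, if_true]

/-- The randomness of the one-level encoding of an input of height `0`. -/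
def bottomZeroEquiv : (Leaf 0 → Rnd) ≃ Rnd × (Fin 3 → Rand 0) :=
  (Equiv.funUnique (Leaf 0) Rnd).trans (Equiv.prodUnique Rnd (Fin 3 → Rand 0)).symm

theorem bottomCode_zero : bottomCode 0 = fun R => rootCode 0 (bottomZeroEquiv R) := by
  funext R l
  have h0 : (bottomZeroEquiv R).1 = R (Fin.init l) := congrArg R (Subsingleton.elim _ _)
  have h1 : Fin.tail l = Fin.init l := Subsingleton.elim _ _
  simp only [bottomCode, rootCode, h0, h1, encode]
  rfl

/-- The randomness of the one-level encoding, split according to the children of the root. -/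
def bottomSuccEquiv (h : ℕ) : (Leaf (h + 1) → Rnd) ≃ (Fin 3 → Leaf h → Rnd) where
  toFun R c p := R (Fin.cons c p)
  invFun R l := R (l 0) (Fin.tail l)
  left_inv R := by funext l; exact congrArg R (Fin.cons_self_tail l)
  right_inv R := by funext c p; simp

theorem bottomCode_succ (h : ℕ) :
    bottomCode (h + 1) = fun R => lift (bottomCode h) (bottomSuccEquiv h R) := by
  funext R l
  have h1 : (Fin.cons (l 0) (Fin.init (Fin.tail l)) : Leaf (h + 1)) = Fin.init l := by
    rw [← Fin.tail_init_eq_init_tail]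
    exact Fin.cons_self_tail (Fin.init l)
  have h2 : Fin.tail l (Fin.last h) = l (Fin.last (h + 1)) := rfl
  simp only [bottomCode, lift, bottomSuccEquiv, Equiv.coe_fn_mk, h1, h2]
  split_ifs
  · simp [h1]
  · simp

/-- At height 0, inserting a level at the leaves is the same as inserting it at the root; greater
heights are lifts. -/
theorem isCode_bottomCode (h : ℕ) : IsCode (bottomCode h) := by
  induction h with
  | zero =>
    rw [bottomCode_zero]
    refine (isCode_rootCode (fun b g => ?_) fun _ _ => rfl).comp_equiv bottomZeroEquiv
    rw [expect_hardOf_zero]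
    exact Fintype.expect_const _
  | succ h ih =>
    rw [bottomCode_succ]
    exact ih.lift.comp_equiv (bottomSuccEquiv h)

/-! ## The uniform encoding -/

/-- The randomness of the `k + 1`-level encoding, with the last level split off. -/
def randEquiv (k : ℕ) : Rand k × (Leaf k → Rnd) ≃ Rand (k + 1) where
  toFun p := Fin.snoc (α := fun d : Fin (k + 1) => Leaf d → Rnd) p.1 p.2
  invFun r := (fun d => r d.castSucc, r (Fin.last k))
  left_inv p := by
    refine Prod.ext (funext fun d => ?_) ?_
    · exact Fin.snoc_castSucc (α := fun d : Fin (k + 1) => Leaf d → Rnd) _ _ _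
    · exact Fin.snoc_last (α := fun d : Fin (k + 1) => Leaf d → Rnd) _ _
  right_inv r := Fin.snoc_init_self (α := fun d : Fin (k + 1) => Leaf d → Rnd) r

theorem expect_rand_succ (k : ℕ) (F : Rand (k + 1) → ℝ) :
    𝔼 r, F r = 𝔼 r : Rand k, 𝔼 R : Leaf k → Rnd, F (randEquiv k (r, R)) := by
  rw [← expect_product', univ_product_univ]
  exact (Fintype.expect_equiv (randEquiv k) _ _ fun _ => rfl).symm

theorem encode_randEquiv (k : ℕ) (y : Bool) (r : Rand k) (R : Leaf k → Rnd) :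
    encode (k + 1) y (randEquiv k (r, R)) = encode₁ (encode k y r) R := by
  have h := (randEquiv k).left_inv (r, R)
  have h1 : (fun d : Fin k => randEquiv k (r, R) d.castSucc) = r := congrArg Prod.fst h
  have h2 : randEquiv k (r, R) (Fin.last k) = R := congrArg Prod.snd h
  rw [encode, h1, h2]

theorem hidden_randEquiv (k : ℕ) (r : Rand k) (R : Leaf k → Rnd) :
    hidden (k + 1) (randEquiv k (r, R)) =
      Fin.snoc (α := fun _ => Fin 3) (hidden k r) (R (hidden k r)).2 := by
  have h := (randEquiv k).left_inv (r, R)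
  have h1 : (fun d : Fin k => randEquiv k (r, R) d.castSucc) = r := congrArg Prod.fst h
  have h2 : randEquiv k (r, R) (Fin.last k) = R := congrArg Prod.snd h
  rw [hidden, h1, h2]

theorem maj3_encode (k : ℕ) (b : Bool) (r : Rand k) : maj3 k (encode k b r) = b := by
  induction k with
  | zero => rfl
  | succ k ih => rw [encode, ← app_bottomCode, (isCode_bottomCode k).maj3_app, ih]

theorem pushes_encode (k : ℕ) (b : Bool) : Pushes univ (hardOf k b) (encode k b) := by
  induction k with
  | zero => intro g; rw [expect_hardOf_zero]; exact Fintype.expect_const _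
  | succ k ih =>
    intro g
    rw [expect_rand_succ, ← (isCode_bottomCode k).expect_app,
      ← ih fun y => 𝔼 R, g (DecTree.app (bottomCode k R) y)]
    simp only [encode_randEquiv, app_bottomCode]

theorem encode_mem_hardOf (k : ℕ) (b : Bool) (r : Rand k) : encode k b r ∈ hardOf k b := by
  -- The indicator of leaving `hardOf k b` has average zero, and a nonnegative function of average
  -- zero vanishes everywhere.
  have h := pushes_encode k b fun x => ind (x ∉ hardOf k b)
  rw [expect_congr (t := hardOf k b) rfl fun x hx => ind_false (not_not.2 hx),
    expect_const_zero, Finset.expect_eq_zero_iff_of_nonneg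
      fun _ _ => ind_nonneg _] at h
  by_contra hr
  have := h r (mem_univ r)
  rw [ind_true hr] at this
  exact one_ne_zero this

/-- The encoded bit influences only the hidden position, so the encoding is a substitution with a
single live variable. -/
theorem encode_eq_ite (k : ℕ) (y : Bool) (r : Rand k) (l : Leaf k) :
    encode k y r l = if l = hidden k r then y else encode k false r l := by
  induction k with
  | zero => rw [if_pos (Subsingleton.elim _ _)]; rfl
  | succ k ih =>
    obtain ⟨⟨r, R⟩, rfl⟩ := (randEquiv k).surjective r
    rw [hidden_randEquiv, encode_randEquiv, encode_randEquiv]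
    have hl : l = Fin.snoc (α := fun _ => Fin 3) (hidden k r) (R (hidden k r)).2 ↔
        Fin.init l = hidden k r ∧ l (Fin.last k) = (R (Fin.init l)).2 := by
      constructor
      · intro h
        have e1 : Fin.init l = hidden k r := by
          rw [h]; exact Fin.init_snoc (α := fun _ => Fin 3) _ _
        refine ⟨e1, ?_⟩
        rw [e1, h]; exact Fin.snoc_last (α := fun _ => Fin 3) _ _
      · rintro ⟨h1, h2⟩
        rw [← h1, ← h2]; exact (Fin.snoc_init_self l).symm
    by_cases h2 : l (Fin.last k) = (R (Fin.init l)).2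
    · by_cases h1 : Fin.init l = hidden k r
      · rw [if_pos (hl.2 ⟨h1, h2⟩), encode₁, enc, if_pos h2, ih, if_pos h1]
      · rw [if_neg fun h => h1 (hl.1 h).1, encode₁, enc, if_pos h2, ih, if_neg h1, encode₁, enc,
          if_pos h2]
    · rw [if_neg fun h => h2 (hl.1 h).2]
      exact enc_of_ne _ _ _ h2

/-- The substitution that realizes the uniform encoding of a single bit. -/
def encodeCode (k : ℕ) (r : Rand k) (l : Leaf k) : Leaf 0 ⊕ Bool :=
  if l = hidden k r then .inl Fin.elim0 else .inr (encode k false r l)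

theorem app_encodeCode (k : ℕ) (r : Rand k) (y : Input 0) :
    DecTree.app (encodeCode k r) y = encode k (y Fin.elim0) r := by
  funext l
  rw [encode_eq_ite, DecTree.app, encodeCode]
  split_ifs <;> rfl

theorem isCode_encodeCode (k : ℕ) : IsCode (encodeCode k) where
  maj3_app r y := by rw [app_encodeCode, maj3_encode, maj3]
  expect_app b g := by
    rw [expect_hardOf_zero]
    simp only [app_encodeCode]
    exact pushes_encode k b g

theorem mem_queried_subst_encodeCode (k : ℕ) (r : Rand k) (y : Input 0) (B : DecTree (Leaf k))
    (p : Leaf 0) : p ∈ (B.subst (encodeCode k r)).queried y ↔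
      hidden k r ∈ B.queried (encode k (y Fin.elim0) r) := by
  rw [DecTree.mem_queried_subst, app_encodeCode]
  constructor
  · rintro ⟨l, hl, h⟩
    by_cases hla : l = hidden k r
    · rwa [← hla]
    · simp [encodeCode, hla] at h
  · intro hp
    exact ⟨_, hp, by simp only [encodeCode, if_true]; exact congrArg _ (Subsingleton.elim _ _)⟩

/-! ### Symmetry under complementation. -/

/-- Complementing the random bits of an encoding. -/
def complRand (k : ℕ) : Rand k ≃ Rand k where
  toFun r d p := (!(r d p).1, (r d p).2)
  invFun r d p := (!(r d p).1, (r d p).2)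
  left_inv r := by simp
  right_inv r := by simp

theorem hidden_complRand (k : ℕ) (r : Rand k) : hidden k (complRand k r) = hidden k r := by
  induction k with
  | zero => rfl
  | succ k ih =>
    have h := ih fun d => r d.castSucc
    simp only [hidden]
    rw [← h]
    rfl

theorem encode_complRand (k : ℕ) (y : Bool) (r : Rand k) :
    encode k (!y) (complRand k r) = fun l => !encode k y r l := by
  induction k with
  | zero => rfl
  | succ k ih =>
    have h := ih fun d => r d.castSucc
    have he : ∀ (v : Bool) (r : Rnd) (a : Fin 3), enc (!v) (!r.1, r.2) a = !enc v r a := by decide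
    funext l
    change enc (encode k (!y) (complRand k fun d => r d.castSucc) (Fin.init l))
      (!(r (Fin.last k) (Fin.init l)).1, (r (Fin.last k) (Fin.init l)).2) (l (Fin.last k)) = _
    rw [h, he]
    rfl

theorem maj3_not (h : ℕ) (x : Input h) : maj3 h (fun l => !x l) = !maj3 h x := by
  induction h with
  | zero => rfl
  | succ h ih =>
    have hs (a : Fin 3) : sub (fun l => !x l) a = fun l => !sub x a l := rfl
    have hm : ∀ u v w : Bool, maj (!u) (!v) (!w) = !maj u v w := by decide
    simp only [maj3, hs, ih, hm]

theorem absMinority_not (h : ℕ) (x : Input h) :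
    absMinority h (fun l => !x l) = absMinority h x := by
  induction h with
  | zero => rfl
  | succ h ih =>
    have hs (a : Fin 3) : sub (fun l => !x l) a = fun l => !sub x a l := rfl
    have hm : ∀ π : Fin 3 → Bool, minorityPos (fun c => !π c) = minorityPos π := by decide
    have hc : minorityChild (fun l => !x l) = minorityChild x := by
      simp only [minorityChild_eq, hs, maj3_not, hm]
    simp only [absMinority, hc, hs, ih]

/-! ## Querying the absolute minority -/

/-- The indicator of the event that `B` queries the absolute minority of its input. -/
noncomputable def minInd (n : ℕ) (B : DecTree (Leaf n)) (x : Input n) : ℝ :=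
  ind (absMinority n x ∈ B.queried x)

theorem minInd_nonneg (n : ℕ) (B : DecTree (Leaf n)) (x : Input n) : 0 ≤ minInd n B x :=
  ind_nonneg _

/-- The functional is a lift of itself with all weight on the minority child, which makes
`Dominates.lift` applicable. -/
theorem minInd_succ (n : ℕ) :
    minInd (n + 1) = liftFun (fun π a => ind (a = minorityPos π)) (minInd n) := by
  funext B x
  rw [liftFun, sum_eq_single (minorityChild x), ind_true (minorityChild_eq x), one_mul]
  · exact ind_congr (absMinority_mem_restrict x B)
  · intro a _ ha
    rw [ind_false (minorityChild_eq x ▸ ha), zero_mul]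
  · simp

theorem liftFun_mul {n : ℕ} (w : (Fin 3 → Bool) → Fin 3 → ℝ) (c : ℝ)
    (F : DecTree (Leaf n) → Input n → ℝ) :
    liftFun w (fun B x => c * F B x) = fun B x => c * liftFun w F B x := by
  funext B x
  simp only [liftFun, mul_sum]
  exact sum_congr rfl fun a _ => by ring

theorem Dominates.lift_minInd {Ω : Type} [Fintype Ω] {m n : ℕ} {f : Ω → Leaf n → Leaf m ⊕ Bool}
    (hf : IsCode f) {c : ℝ} (hd : Dominates f (minInd m) fun B x => c * minInd n B x) :
    Dominates (RecMaj.lift f) (minInd (m + 1)) fun B x => c * minInd (n + 1) B x := by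
  have h := hd.lift hf (w := fun π a => ind (a = minorityPos π)) fun _ _ => ind_nonneg _
  rwa [liftFun_mul, ← minInd_succ, ← minInd_succ] at h

/-- Every leaf is the absolute minority of some hard input. -/
theorem exists_absMinority_eq (h : ℕ) (b : Bool) (l : Leaf h) :
    ∃ x ∈ hardOf h b, absMinority h x = l := by
  induction h generalizing b with
  | zero =>
    obtain ⟨x, hx⟩ := hardOf_nonempty 0 b
    exact ⟨x, hx, Subsingleton.elim _ _⟩
  | succ h ih =>
    -- The child above `l` becomes the minority child, with value `!b`; its two siblings get an
    -- arbitrary hard input of value `b`.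
    obtain ⟨w, hw, hwl⟩ := ih (!b) (Fin.tail l)
    obtain ⟨v, hv⟩ := hardOf_nonempty h b
    rw [mem_hardOf] at hw hv
    have key : ∀ (b : Bool) (a : Fin 3), (fun c => if c = a then !b else b) ∈ patterns b ∧
        minorityPos (fun c => if c = a then !b else b) = a := by decide
    have hp : (fun c => maj3 h (if c = l 0 then w else v)) = fun c => if c = l 0 then !b else b := by
      funext c; split_ifs <;> simp [hw, hv]
    refine ⟨glue fun c => if c = l 0 then w else v, ?_, ?_⟩
    · rw [mem_hardOf_succ]
      simp only [sub_glue, hp]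
      exact ⟨(key b _).1, fun c => by split_ifs <;> simp [hw, hv]⟩
    · rw [absMinority, minorityChild_eq]
      simp only [sub_glue, hp, (key b _).2, if_true, hwl]
      exact Fin.cons_self_tail l

/-! ## The ratio of the two query probabilities -/

/-- Preimages of a `0`-hard input have `y = false`, and all fibers have the same size because the
encoding is uniform. Hence a uniform `x` with a uniform preimage is just a uniform `r`. -/
theorem queryHiddenProb_eq {k : ℕ} (C : DecTree (Leaf k)) :
    queryHiddenProb C = 𝔼 r, ind (hidden k r ∈ C.queried (encode k false r)) := by
  have hN : (#(hardOf k false) : ℝ) ≠ 0 :=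
    Nat.cast_ne_zero.2 (card_pos.2 (hardOf_nonempty k false)).ne'
  have hR : (Fintype.card (Rand k) : ℝ) ≠ 0 := Nat.cast_ne_zero.2 Fintype.card_ne_zero
  set T : Input k → Finset (Rand k) := fun x => {r | encode k false r = x} with hT
  have hfib : ∀ x ∈ hardOf k false, 𝔼 yr ∈ fiber k x,
      (if hidden k yr.2 ∈ C.queried x then (1 : ℝ) else 0) =
      𝔼 r ∈ T x, ind (hidden k r ∈ C.queried (encode k false r)) := by
    intro x hx
    have hy (y : Bool) (r : Rand k) (h : encode k y r = x) : y = false := by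
      rw [← maj3_encode k y r, h, (mem_hardOf.1 hx).2]
    refine expect_nbij' (fun yr => yr.2) (fun r => (false, r)) ?_ ?_ ?_ ?_ ?_
    · rintro ⟨y, r⟩ h
      simp only [fiber, mem_filter, mem_univ, true_and] at h
      simp only [hT, mem_filter, mem_univ, true_and]
      rwa [← hy y r h]
    · intro r h
      simpa [fiber, hT] using h
    · rintro ⟨y, r⟩ h
      simp only [fiber, mem_filter, mem_univ, true_and] at h
      rw [hy y r h]
    · intro r _; rfl
    · rintro ⟨y, r⟩ h
      simp only [fiber, mem_filter, mem_univ, true_and] at h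
      obtain rfl := hy y r h
      subst h
      exact ite_eq_ind _
  have hcard : ∀ x ∈ hardOf k false,
      (#(T x) : ℝ) = Fintype.card (Rand k) / #(hardOf k false) := by
    intro x hx
    have h := pushes_encode k false fun x' => ind (x' = x)
    have h1 : ∑ r : Rand k, ind (encode k false r = x) = #(T x) := by
      simp only [← ite_eq_ind, sum_boole, hT]
    have h2 : ∑ x' ∈ hardOf k false, ind (x' = x) = 1 := by
      simp only [← ite_eq_ind, sum_ite_eq', hx, if_true]
    rw [expect_eq_sum_div_card, expect_eq_sum_div_card, h1, h2, card_univ,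
      div_eq_div_iff hR hN] at h
    rw [eq_div_iff hN, h, one_mul]
  change 𝔼 x ∈ hardOf k false, _ = _
  rw [expect_congr rfl hfib, expect_eq_sum_div_card,
    sum_congr rfl fun x hx => (expect_eq_sum_div_card _ _).trans (by rw [hcard x hx]),
    ← sum_div, Fintype.expect_eq_sum_div_card, hT,
    sum_fiberwise_of_maps_to (fun r _ => encode_mem_hardOf k false r)]
  field_simp

theorem queryMinorityProb₀_eq {k : ℕ} (C : DecTree (Leaf k)) :
    queryMinorityProb₀ C = 𝔼 x ∈ hardOf k false, minInd k C x := by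
  simp only [queryMinorityProb₀, ite_eq_ind]
  rfl

/-- The variable at the root of `C` is always queried, and it is the absolute minority of some
`0`-hard input. -/
theorem queryMinorityProb₀_pos {k : ℕ} {C : DecTree (Leaf k)} (hC : C.QueriesSomething) :
    0 < queryMinorityProb₀ C := by
  cases C with
  | leaf b => obtain ⟨x, hx⟩ := hC; simp [DecTree.queried] at hx
  | node i t₀ t₁ =>
    obtain ⟨x, hx, hi⟩ := exists_absMinority_eq k false i
    rw [queryMinorityProb₀_eq]
    refine expect_pos' (fun _ _ => minInd_nonneg _ _ _) ⟨x, hx, ?_⟩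
    rw [minInd, ind_true (by simp [hi, DecTree.queried])]
    exact one_pos

theorem expect_hidden_le_alpha {k : ℕ} (C : DecTree (Leaf k)) :
    𝔼 r, ind (hidden k r ∈ C.queried (encode k false r)) ≤
      alpha k * 𝔼 x ∈ hardOf k false, minInd k C x := by
  by_cases hC : C.QueriesSomething
  · have h := (alpha_isGreatest k).2 ⟨C, hC, rfl⟩
    rwa [ratio, div_le_iff₀ (queryMinorityProb₀_pos hC), queryHiddenProb_eq,
      queryMinorityProb₀_eq] at h
  · have h (x : Input k) (l : Leaf k) : l ∉ C.queried x := fun hl => hC ⟨x, l, hl⟩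
    simp [minInd, ind_false (h _ _)]

/-- For value `0` this is the maximality of `alpha`. Value `1` follows by complementing the input
and the random bits, which fixes the hidden position and the absolute minority and turns `B` into
`B.flip`. -/
theorem dominates_encodeCode (k : ℕ) :
    Dominates (encodeCode k) (minInd 0) fun B x => alpha k * minInd k B x := by
  intro b B
  rw [expect_hardOf_zero, ← mul_expect]
  have h (r : Rand k) : minInd 0 (B.subst (encodeCode k r)) (fun _ => b) =
      ind (hidden k r ∈ B.queried (encode k b r)) :=
    ind_congr (mem_queried_subst_encodeCode k r _ B _)
  simp only [h]
  cases b with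
  | false => exact expect_hidden_le_alpha B
  | true =>
    have hl : 𝔼 r, ind (hidden k r ∈ B.queried (encode k true r)) =
        𝔼 r, ind (hidden k r ∈ B.flip.queried (encode k false r)) := by
      refine (Fintype.expect_equiv (complRand k) _ _ fun r => ?_).symm
      rw [hidden_complRand, show true = !false from rfl, encode_complRand, DecTree.queried_flip]
    have hr : 𝔼 x ∈ hardOf k true, minInd k B x = 𝔼 x ∈ hardOf k false, minInd k B.flip x := by
      rw [← pushes_encode, ← pushes_encode]
      refine (Fintype.expect_equiv (complRand k) _ _ fun r => ?_).symm
      rw [show true = !false from rfl, encode_complRand, minInd, minInd, absMinority_not,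
        DecTree.queried_flip]
    rw [hl, hr]
    exact expect_hidden_le_alpha B.flip

/-- Lifting `encodeCode k` `h` times encodes each leaf of height `h` independently, with the same
factor. -/
theorem exists_code_add (k h : ℕ) : ∃ (Ω : Type) (_ : Fintype Ω) (_ : Nonempty Ω)
    (f : Ω → Leaf (k + h) → Leaf h ⊕ Bool), IsCode f ∧
      Dominates f (minInd h) fun B x => alpha k * minInd (k + h) B x := by
  induction h with
  | zero => exact ⟨_, _, inferInstance, encodeCode k, isCode_encodeCode k, dominates_encodeCode k⟩
  | succ h ih =>
    obtain ⟨Ω, _, _, f, hf, hd⟩ := ih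
    exact ⟨_, _, inferInstance, lift f, hf.lift, hd.lift_minInd hf⟩

/-! ## The one-level encoding loses at most a factor of two -/

/-- The input of height `1` whose values at the leaves are `b`, except at the leaf `m`. -/
def oneOdd (b : Bool) (m : Fin 3) : Input 1 := fun l => if l 0 = m then !b else b

/-- On both inputs the tree only ever sees the answer `b`, so the two runs coincide. -/
theorem not_mem_queried_oneOdd (b : Bool) {j k : Fin 3} (B : DecTree (Leaf 1))
    (hj : (fun _ => j) ∉ B.queried (oneOdd b j)) (hk : (fun _ => k) ∉ B.queried (oneOdd b k)) :
    (fun _ => k) ∉ B.queried (oneOdd b j) ∧ (fun _ => j) ∉ B.queried (oneOdd b k) := by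
  induction B with
  | leaf c => simp [DecTree.queried]
  | node i t₀ t₁ h₀ h₁ =>
    simp only [DecTree.queried, mem_insert, not_or] at hj hk ⊢
    have hij : i 0 ≠ j := fun h => hj.1 (by
      rw [← h]; funext p; exact congrArg i (Subsingleton.elim 0 p))
    have hik : i 0 ≠ k := fun h => hk.1 (by
      rw [← h]; funext p; exact congrArg i (Subsingleton.elim 0 p))
    have ej : oneOdd b j i = b := by simp [oneOdd, hij]
    have ek : oneOdd b k i = b := by simp [oneOdd, hik]
    rw [ej] at hj ⊢
    rw [ek] at hk ⊢
    cases b with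
    | false => exact ⟨⟨hk.1, (h₀ hj.2 hk.2).1⟩, hj.1, (h₀ hj.2 hk.2).2⟩
    | true => exact ⟨⟨hk.1, (h₁ hj.2 hk.2).1⟩, hj.1, (h₁ hj.2 hk.2).2⟩

/-- The variable at the root of the tree contributes 1 to the sum on the right. If another variable
contributes too, the right side is at least 8, against at most 6 terms on the left. Otherwise the
other two variables satisfy `not_mem_queried_oneOdd`, which kills two of the six terms. -/
theorem sum_ind_oneOdd_le (b : Bool) (B : DecTree (Leaf 1)) :
    ∑ m : Fin 3, ∑ a : Fin 3, (if a = m then 0 else ind ((fun _ => a) ∈ B.queried (oneOdd b m))) ≤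
      4 * ∑ m : Fin 3, ind ((fun _ => m) ∈ B.queried (oneOdd b m)) := by
  cases hB : B with
  | leaf c => simp [DecTree.queried, ind_false]
  | node i t₀ t₁ =>
    rw [← hB]
    set q : Fin 3 → Fin 3 → ℝ := fun m a => ind ((fun _ => a) ∈ B.queried (oneOdd b m)) with hq
    have h1 (m) : q m (i 0) = 1 := ind_true (by
      rw [hB, show (fun _ => i 0) = i from funext fun p => congrArg i (Subsingleton.elim 0 p)]
      simp [DecTree.queried])
    have hle (m a) : q m a ≤ 1 := ind_le_one _
    have h0 (m a) : 0 ≤ q m a := ind_nonneg _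
    have hd (j k) : (q j j = 0 ∧ q k k = 0 → q j k = 0 ∧ q k j = 0) ∧ (q j j = 0 ∨ q j j = 1) := by
      constructor
      · rintro ⟨hj, hk⟩
        have hn {m a} (h : q m a = 0) : (fun _ => a) ∉ B.queried (oneOdd b m) := fun hm => by
          rw [hq] at h; simp only [ind_true hm] at h; exact one_ne_zero h
        obtain ⟨h1, h2⟩ := not_mem_queried_oneOdd b B (hn hj) (hn hk)
        exact ⟨ind_false h1, ind_false h2⟩
      · by_cases h : (fun _ => j) ∈ B.queried (oneOdd b j)
        · exact Or.inr (ind_true h)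
        · exact Or.inl (ind_false h)
    change ∑ m : Fin 3, ∑ a : Fin 3, (if a = m then 0 else q m a) ≤ 4 * ∑ m : Fin 3, q m m
    clear_value q
    simp only [Fin.sum_univ_three, if_true, if_neg (show (0 : Fin 3) ≠ 1 by decide),
      if_neg (show (0 : Fin 3) ≠ 2 by decide), if_neg (show (1 : Fin 3) ≠ 0 by decide),
      if_neg (show (1 : Fin 3) ≠ 2 by decide), if_neg (show (2 : Fin 3) ≠ 0 by decide),
      if_neg (show (2 : Fin 3) ≠ 1 by decide)]
    have hij := hle 0 1
    have hik := hle 0 2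
    have hji := hle 1 0
    have hjk := hle 1 2
    have hki := hle 2 0
    have hkj := hle 2 1
    obtain h | h | h : i 0 = 0 ∨ i 0 = 1 ∨ i 0 = 2 := by generalize i 0 = a; revert a; decide
    · have h00 := h1 0; rw [h] at h00
      rcases (hd 1 2).2 with e1 | e1 <;> rcases (hd 2 1).2 with e2 | e2
      · have := (hd 1 2).1 ⟨e1, e2⟩; linarith
      all_goals linarith
    · have h00 := h1 1; rw [h] at h00
      rcases (hd 0 2).2 with e1 | e1 <;> rcases (hd 2 0).2 with e2 | e2
      · have := (hd 0 2).1 ⟨e1, e2⟩; linarith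
      all_goals linarith
    · have h00 := h1 2; rw [h] at h00
      rcases (hd 0 1).2 with e1 | e1 <;> rcases (hd 1 0).2 with e2 | e2
      · have := (hd 0 1).1 ⟨e1, e2⟩; linarith
      all_goals linarith

theorem sum_patterns (b : Bool) (K : (Fin 3 → Bool) → ℝ) :
    ∑ π ∈ patterns b, K π = ∑ m : Fin 3, K fun c => if c = m then !b else b := by
  have k1 : ∀ (b : Bool) (m : Fin 3), (fun c => if c = m then !b else b) ∈ patterns b ∧
      minorityPos (fun c => if c = m then !b else b) = m := by decide
  have k2 : ∀ (b : Bool), ∀ π ∈ patterns b,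
      (fun c => if c = minorityPos π then !b else b) = π := by decide
  refine sum_nbij' minorityPos (fun m c => if c = m then !b else b) (by simp)
    (fun m _ => (k1 b m).1) (k2 b) (fun m _ => (k1 b m).2) fun π hπ => ?_
  rw [k2 b π hπ]

/-- Given the triple, the hidden position is uniform among the two majority leaves. This halving and
the factor 2 account for the 4 in `sum_ind_oneOdd_le`. -/
theorem dominates_bottomCode_zero :
    Dominates (bottomCode 0) (minInd 0) fun B x => 2 * minInd 1 B x := by
  rw [bottomCode_zero]
  refine Dominates.comp_equiv (fun b B => ?_) bottomZeroEquiv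
  have hs (b : Bool) : Pushes univ (hardOf 0 b) (encode 0 b) := pushes_encode 0 b
  have hl (y : Input 0) (ω : Rnd × (Fin 3 → Rand 0)) : minInd 0 (B.subst (rootCode 0 ω)) y =
      ind ((fun _ => ω.1.2) ∈ B.queried (DecTree.app (rootCode 0 ω) y)) := by
    refine ind_congr ((mem_queried_subst_rootCode 0 ω y B _).trans (Eq.to_iff ?_))
    congr 1
    funext p
    rw [Fin.fin_one_eq_zero p]; rfl
  have hz (π : Fin 3 → Bool) (F : (Fin 3 → Input 0) → ℝ) :
      𝔼 z ∈ Fintype.piFinset fun c => hardOf 0 (π c), F z = F fun c _ => π c := by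
    have hp := pushes_piFinset (s := fun _ : Fin 3 => (univ : Finset (Rand 0)))
      (t := fun c => hardOf 0 (π c)) (fun c => hs (π c)) F
    rw [← hp, Fintype.piFinset_univ]
    exact Fintype.expect_const _
  have hg (m : Fin 3) : (glue fun c _ => if c = m then !b else b) = oneOdd b m := rfl
  have key : ∀ (b : Bool) (m a : Fin 3), (if a = m then !b else b) = b ↔ ¬ a = m := by decide
  have hm (m : Fin 3) : absMinority 1 (oneOdd b m) = fun _ => m := by
    have k2 : ∀ (b : Bool) (m : Fin 3),
        minorityPos (fun c => if c = m then !b else b) = m := by decide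
    funext p
    rw [Fin.fin_one_eq_zero p]
    exact k2 b m
  rw [expect_hardOf_succ]
  simp only [hl]
  rw [expect_rootCode hs b fun x a => ind ((fun _ => a) ∈ B.queried x)]
  simp only [hz, expect_eq_sum_div_card, card_patterns, sum_patterns, hg, minInd, hm, ← sum_div,
    ← mul_sum]
  have h := sum_ind_oneOdd_le b B
  have e (m a : Fin 3) : ind ((if a = m then !b else b) = b) *
      ind ((fun _ => a) ∈ B.queried (oneOdd b m)) =
      if a = m then 0 else ind ((fun _ => a) ∈ B.queried (oneOdd b m)) := by
    rw [ind_congr (key b m a)]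
    by_cases h : a = m
    · rw [if_pos h, ind_false (not_not.2 h), zero_mul]
    · rw [if_neg h, ind_true h, one_mul]
  simp only [e]
  rw [div_le_div_iff_of_pos_right (by norm_num)]
  linarith

theorem dominates_bottomCode (h : ℕ) :
    Dominates (bottomCode h) (minInd h) fun B x => 2 * minInd (h + 1) B x := by
  induction h with
  | zero => exact dominates_bottomCode_zero
  | succ h ih =>
    rw [bottomCode_succ]
    exact (ih.lift_minInd (isCode_bottomCode h)).comp_equiv (bottomSuccEquiv h)

/-! ## Bounds on `alpha` -/

theorem expect_hidden_le_two_pow (k : ℕ) (C : DecTree (Leaf k)) :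
    𝔼 r, ind (hidden k r ∈ C.queried (encode k false r)) ≤
      2 ^ k * 𝔼 x ∈ hardOf k false, minInd k C x := by
  induction k with
  | zero =>
    rw [← pushes_encode, pow_zero, one_mul]
    refine le_of_eq (expect_congr rfl fun r _ => ?_)
    rw [minInd, Subsingleton.elim (hidden 0 r) (absMinority 0 (encode 0 false r))]
  | succ k ih =>
    -- For a fixed last level `R`, the run is that of the substituted tree on a `k`-level encoding,
    -- so the induction hypothesis applies; averaging over `R` then costs a factor 2.
    rw [expect_rand_succ, expect_comm]
    calc 𝔼 R : Leaf k → Rnd, 𝔼 r : Rand k, ind (hidden (k + 1) (randEquiv k (r, R)) ∈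
          C.queried (encode (k + 1) false (randEquiv k (r, R))))
        = 𝔼 R : Leaf k → Rnd, 𝔼 r : Rand k,
          ind (hidden k r ∈ (C.subst (bottomCode k R)).queried (encode k false r)) := by
          refine expect_congr rfl fun R _ => expect_congr rfl fun r _ => ?_
          rw [hidden_randEquiv, encode_randEquiv]
          exact ind_congr (mem_queried_subst_bottomCode k R _ C _).symm
      _ ≤ 𝔼 R : Leaf k → Rnd, 2 ^ k * 𝔼 y ∈ hardOf k false,
          minInd k (C.subst (bottomCode k R)) y := expect_le_expect fun R _ => ih _
      _ = 2 ^ k * 𝔼 y ∈ hardOf k false, 𝔼 R : Leaf k → Rnd,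
          minInd k (C.subst (bottomCode k R)) y := by rw [← mul_expect, expect_comm]
      _ ≤ 2 ^ k * 𝔼 x ∈ hardOf (k + 1) false, 2 * minInd (k + 1) C x :=
          mul_le_mul_of_nonneg_left (dominates_bottomCode k false C) (by positivity)
      _ = _ := by rw [← mul_expect]; ring

theorem alpha_le_two_pow (k : ℕ) : alpha k ≤ 2 ^ k := by
  obtain ⟨C, hC, h⟩ := (alpha_isGreatest k).1
  rw [h, ratio, div_le_iff₀ (queryMinorityProb₀_pos hC), queryHiddenProb_eq,
    queryMinorityProb₀_eq]
  exact expect_hidden_le_two_pow k C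

/-- A tree that always queries every variable has ratio 1. -/
theorem one_le_alpha (k : ℕ) : 1 ≤ alpha k := by
  obtain ⟨C, -, hC⟩ := DecTree.exists_eval_eq (ι := Leaf k) fun _ => false
  have h := expect_hidden_le_alpha C
  have h1 (x : Input k) (l : Leaf k) : ind (l ∈ C.queried x) = 1 := ind_true (by simp [hC])
  simp only [minInd, h1] at h
  rwa [Fintype.expect_const, expect_const (hardOf_nonempty k false), mul_one] at h

/-! ## Counting the queried leaves -/

/-- The number of leaves queried by `B` that are reached from the root by `t` arbitrary steps,
followed by steps to the child whose value disagrees with its parent. -/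
noncomputable def countFrom : ℕ → (n : ℕ) → DecTree (Leaf n) → Input n → ℝ
  | 0, n, B, x => minInd n B x
  | _ + 1, 0, _, _ => 0
  | t + 1, n + 1, B, x => ∑ a, countFrom t n (restrict x a B) (sub x a)

theorem liftFun_one_countFrom (t n : ℕ) :
    liftFun (fun _ _ => 1) (countFrom t n) = countFrom (t + 1) (n + 1) := by
  funext B x
  simp only [liftFun, one_mul, countFrom]

theorem countFrom_self (n : ℕ) (B : DecTree (Leaf n)) (x : Input n) :
    countFrom n n B x = #(B.queried x) := by
  induction n with
  | zero =>
    rw [countFrom, minInd]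
    by_cases h : absMinority 0 x ∈ B.queried x
    · rw [ind_true h, eq_comm, Nat.cast_eq_one, card_eq_one]
      exact ⟨_, eq_singleton_iff_unique_mem.2 ⟨h, fun _ _ => Subsingleton.elim _ _⟩⟩
    · rw [ind_false h, eq_comm, Nat.cast_eq_zero, card_eq_zero, eq_empty_iff_forall_notMem]
      exact fun l hl => h (by rwa [Subsingleton.elim (absMinority 0 x) l])
  | succ n ih =>
    simp only [countFrom, ih]
    rw [← Nat.cast_sum, Nat.cast_inj, ← card_sigma]
    refine card_nbij' (fun p => Fin.cons p.1 p.2) (fun l => ⟨l 0, Fin.tail l⟩) ?_ ?_ ?_ ?_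
    · rintro ⟨a, p⟩ h
      simpa [mem_queried_restrict] using h
    · intro l h
      simpa [mem_queried_restrict] using h
    · rintro ⟨a, p⟩ _; simp
    · intro l _; simp

/-- The difference counts the leaves whose step number `t + 1` goes to one of the two majority
children. The code inserts a level at depth `t` and hides the old subtree below a random majority
child, whence the factor 2. It is `rootCode` lifted `t` times with all weights 1. -/
theorem exists_code_count (t : ℕ) : ∀ n, t ≤ n →
    ∃ (Ω : Type) (_ : Fintype Ω) (_ : Nonempty Ω) (f : Ω → Leaf (n + 1) → Leaf n ⊕ Bool),
      IsCode f ∧ Dominates f (fun B x => 2 * countFrom t n B x)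
        fun B x => countFrom (t + 1) (n + 1) B x - countFrom t (n + 1) B x := by
  induction t with
  | zero =>
    intro n _
    have hs (b : Bool) : Pushes univ (hardOf n b) (encode n b) := pushes_encode n b
    refine ⟨_, _, inferInstance, rootCode n, isCode_rootCode hs (maj3_encode n), fun b B => ?_⟩
    have hl (y : Input n) (ω : Rnd × (Fin 3 → Rand n)) :
        2 * countFrom 0 n (B.subst (rootCode n ω)) y =
        2 * minInd n (restrict (DecTree.app (rootCode n ω) y) ω.1.2 B)
          (sub (DecTree.app (rootCode n ω) y) ω.1.2) := by
      have hy : sub (DecTree.app (rootCode n ω) y) ω.1.2 = y := by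
        rw [app_rootCode n ω y true, sub_glue, Function.update_self]
      rw [countFrom, minInd, minInd]
      congr 1
      refine ind_congr ((mem_queried_subst_rootCode n ω y B _).trans ?_)
      rw [mem_queried_restrict, hy]
    simp only [hl]
    rw [expect_rootCode hs b fun x a => 2 * minInd n (restrict x a B) (sub x a),
      expect_hardOf_succ]
    refine expect_le_expect fun π hπ => expect_le_expect fun z hz => le_of_eq ?_
    have hz' : (fun c => maj3 n (z c)) = π :=
      funext fun c => (mem_hardOf.1 (Fintype.mem_piFinset.1 hz c)).2
    have key : ∀ (b : Bool), ∀ π ∈ patterns b, ∀ a, a = minorityPos π ↔ ¬ π a = b := by decide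
    simp only [countFrom, minInd_succ, liftFun, sub_glue, hz', sum_div, ← sum_sub_distrib]
    refine sum_congr rfl fun a _ => ?_
    by_cases ha : π a = b
    · rw [ind_true ha, ind_false fun h => (key b π hπ a).1 h ha]; ring
    · rw [ind_false ha, ind_true ((key b π hπ a).2 ha)]; ring
  | succ t ih =>
    intro n hn
    obtain ⟨n, rfl⟩ : ∃ n', n = n' + 1 := ⟨n - 1, by omega⟩
    obtain ⟨Ω, _, _, f, hf, hd⟩ := ih n (by omega)
    refine ⟨_, _, inferInstance, lift f, hf.lift, ?_⟩
    have h := hd.lift hf (w := fun _ _ => 1) fun _ _ => zero_le_one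
    rw [liftFun_mul, liftFun_one_countFrom] at h
    have h2 : (liftFun (fun _ _ => 1) fun B x =>
        countFrom (t + 1) (n + 1) B x - countFrom t (n + 1) B x) = fun B x =>
        countFrom (t + 1 + 1) (n + 1 + 1) B x - countFrom (t + 1) (n + 1 + 1) B x := by
      funext B x
      simp only [liftFun, one_mul, sum_sub_distrib]
      rfl
    rwa [h2] at h

open MeasureTheory

/-! ## Expectations over randomized decision trees -/

/-- Every set of decision trees is measurable. -/
instance measurableSpaceDecTree {ι : Type} : MeasurableSpace (DecTree ι) := ⊤

instance discreteMeasurableSpaceDecTree {ι : Type} : DiscreteMeasurableSpace (DecTree ι) :=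
  ⟨fun _ => trivial⟩

namespace RandTree

variable {ι κ : Type}

theorem integrable_of_bound (A : RandTree ι) {g : DecTree ι → ℝ} {C : ℝ} (hg : ∀ B, |g B| ≤ C) :
    Integrable g (PMF.toMeasure A) :=
  Integrable.of_bound (Measurable.of_discrete.aestronglyMeasurable) C (.of_forall hg)

/-- Bounded functionals are integrable, so monotonicity and linearity come from the integral. -/
theorem expect_eq_integral (A : RandTree ι) {g : DecTree ι → ℝ} {C : ℝ} (hg : ∀ B, |g B| ≤ C) :
    A.expect g = ∫ B, g B ∂(PMF.toMeasure A) := by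
  rw [PMF.integral_eq_tsum A g (A.integrable_of_bound hg)]
  rfl

theorem expect_map (A : RandTree ι) (φ : DecTree ι → DecTree κ) {g : DecTree κ → ℝ} {C : ℝ}
    (hg : ∀ B, |g B| ≤ C) : expect (PMF.map φ A) g = A.expect fun B => g (φ B) := by
  rw [expect_eq_integral _ hg, expect_eq_integral A fun B => hg (φ B),
    ← PMF.toMeasure_map (p := A) (f := φ) Measurable.of_discrete,
    integral_map Measurable.of_discrete.aemeasurable
      Measurable.of_discrete.aestronglyMeasurable]

theorem expect_mono (A : RandTree ι) {f g : DecTree ι → ℝ} {C D : ℝ} (hf : ∀ B, |f B| ≤ C)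
    (hg : ∀ B, |g B| ≤ D) (h : ∀ B, f B ≤ g B) : A.expect f ≤ A.expect g := by
  rw [expect_eq_integral A hf, expect_eq_integral A hg]
  exact integral_mono (A.integrable_of_bound hf) (A.integrable_of_bound hg) h

theorem expect_const_mul (A : RandTree ι) (g : DecTree ι → ℝ) (c : ℝ) :
    (A.expect fun B => c * g B) = c * A.expect g := by
  unfold expect
  rw [← tsum_mul_left]
  exact tsum_congr fun B => by ring

theorem expect_sub (A : RandTree ι) {f g : DecTree ι → ℝ} {C D : ℝ} (hf : ∀ B, |f B| ≤ C)
    (hg : ∀ B, |g B| ≤ D) : (A.expect fun B => f B - g B) = A.expect f - A.expect g := by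
  have h : ∀ B, |f B - g B| ≤ C + D := fun B => (abs_sub _ _).trans (add_le_add (hf B) (hg B))
  rw [expect_eq_integral A hf, expect_eq_integral A hg, expect_eq_integral A h,
    integral_sub (A.integrable_of_bound hf) (A.integrable_of_bound hg)]

theorem expect_one (A : RandTree ι) : (A.expect fun _ => 1) = 1 := by
  rw [expect_eq_integral A (C := 1) (by simp)]
  simp

theorem expect_nonneg (A : RandTree ι) {g : DecTree ι → ℝ} (h : ∀ B, 0 ≤ g B) :
    0 ≤ A.expect g :=
  tsum_nonneg fun B => mul_nonneg ENNReal.toReal_nonneg (h B)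

theorem expect_expect {α : Type*} (A : RandTree ι) (s : Finset α) {g : α → DecTree ι → ℝ} {C : ℝ}
    (hg : ∀ a B, |g a B| ≤ C) :
    (A.expect fun B => 𝔼 a ∈ s, g a B) = 𝔼 a ∈ s, A.expect (g a) := by
  have h (a : α) : Summable fun B => (A B).toReal * g a B := by
    have h1 : Summable fun B => (A B).toReal * C :=
      (ENNReal.summable_toReal (by rw [A.tsum_coe]; exact ENNReal.one_ne_top)).mul_right C
    refine Summable.of_norm_bounded h1 fun B => ?_
    rw [norm_mul, Real.norm_of_nonneg ENNReal.toReal_nonneg]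
    exact mul_le_mul_of_nonneg_left (hg a B) ENNReal.toReal_nonneg
  simp only [expect_eq_sum_div_card, expect, mul_div_assoc', mul_sum]
  rw [tsum_div_const, Summable.tsum_finsetSum fun a _ => h a]

theorem prob_eq (A : RandTree ι) (P : DecTree ι → Prop) : A.prob P = A.expect fun B => ind (P B) := by
  simp only [prob, ite_eq_ind]

end RandTree

theorem abs_ind_le (p : Prop) : |ind p| ≤ 1 := by
  rw [abs_of_nonneg (ind_nonneg p)]; exact ind_le_one p

theorem RandTree.Computes.map_subst {m n : ℕ} {A : RandTree (Leaf n)} {δ : ℝ}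
    (hA : A.Computes (maj3 n) δ) {f : Leaf n → Leaf m ⊕ Bool}
    (hf : ∀ y, maj3 n (DecTree.app f y) = maj3 m y) :
    RandTree.Computes (PMF.map (DecTree.subst f) A) (maj3 m) δ := by
  intro y
  rw [RandTree.prob_eq, RandTree.expect_map _ _ fun B => abs_ind_le _]
  simp only [DecTree.eval_subst, ← hf]
  rw [← RandTree.prob_eq]
  exact hA _

/-- The expectation of the functional `F` of a random decision tree and a random hard input. -/
noncomputable def average {n : ℕ} (F : DecTree (Leaf n) → Input n → ℝ) (A : RandTree (Leaf n)) :
    ℝ :=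
  𝔼 x ∈ hard n, A.expect fun B => F B x

/-- Passes from deterministic to randomized trees and from inputs of fixed value to all hard inputs,
by averaging over `A` and over the two values. -/
theorem Dominates.average_le {Ω : Type} [Fintype Ω] {m n : ℕ} {f : Ω → Leaf n → Leaf m ⊕ Bool}
    {F : DecTree (Leaf m) → Input m → ℝ} {G : DecTree (Leaf n) → Input n → ℝ}
    (hd : Dominates f F G) {C D : ℝ} (hF : ∀ B y, |F B y| ≤ C) (hG : ∀ B x, |G B x| ≤ D)
    (A : RandTree (Leaf n)) :
    𝔼 ω, average F (PMF.map (DecTree.subst (f ω)) A) ≤ average G A := by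
  have h1 (B : DecTree (Leaf n)) :
      𝔼 p ∈ univ ×ˢ hard m, F (B.subst (f p.1)) p.2 ≤ 𝔼 x ∈ hard n, G B x := by
    rw [expect_product, expect_comm, expect_hard, expect_hard]
    have h0 := hd false B
    have h1 := hd true B
    linarith
  have bound {α : Type} (s : Finset α) (g : α → ℝ) {C : ℝ} (hs : s.Nonempty)
      (hg : ∀ a, |g a| ≤ C) : |𝔼 a ∈ s, g a| ≤ C :=
    (abs_expect_le s g).trans (expect_le hs fun a _ => hg a)
  have hn : (univ ×ˢ hard m : Finset (Ω × Input m)).Nonempty ∨ IsEmpty Ω := by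
    rcases isEmpty_or_nonempty Ω with h | h
    · exact Or.inr h
    · exact Or.inl (univ_nonempty.product (hard_nonempty m))
  have hC : 0 ≤ C := (abs_nonneg _).trans (hF (.leaf true) fun _ => true)
  have h2 := A.expect_mono (C := C) (D := D) (fun B => ?_)
    (fun B => bound (hard n) (G B) (hard_nonempty n) (hG B)) h1
  · rw [A.expect_expect _ fun p B => hF _ _, A.expect_expect _ fun x B => hG _ _,
      expect_product] at h2
    simpa only [average, RandTree.expect_map _ _ fun B => hF B _] using h2
  · rcases hn with hn | hn
    · exact bound _ _ hn fun p => hF _ _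
    · simpa using hC

/-! ## The query probability of the absolute minority -/

theorem abs_minInd_le (n : ℕ) (B : DecTree (Leaf n)) (x : Input n) : |minInd n B x| ≤ 1 :=
  abs_ind_le _

theorem queryMinorityProb_eq {n : ℕ} (A : RandTree (Leaf n)) :
    queryMinorityProb A = average (minInd n) A := by
  simp only [queryMinorityProb, RandTree.prob_eq]
  rfl

theorem queryMinorityProb_nonneg {n : ℕ} (A : RandTree (Leaf n)) : 0 ≤ queryMinorityProb A := by
  rw [queryMinorityProb_eq]
  exact Finset.expect_nonneg fun x _ => A.expect_nonneg fun B => minInd_nonneg n B x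

theorem exists_computes {n : ℕ} {δ : ℝ} (hδ : 0 ≤ δ) :
    ∃ A : RandTree (Leaf n), A.Computes (maj3 n) δ := by
  obtain ⟨B, hB, -⟩ := DecTree.exists_eval_eq (maj3 n)
  refine ⟨PMF.pure B, fun x => ?_⟩
  refine le_of_eq_of_le ?_ hδ
  rw [RandTree.prob_eq, RandTree.expect]
  refine (tsum_congr fun B' => ?_).trans tsum_zero
  by_cases h : B' = B
  · rw [h, hB, ind_false (by simp), mul_zero]
  · rw [PMF.pure_apply_of_ne _ _ h, ENNReal.toReal_zero, zero_mul]

theorem minQueryProb_nonneg (δ : ℝ) (n : ℕ) : 0 ≤ minQueryProb δ n :=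
  Real.sInf_nonneg (by rintro p ⟨A, -, rfl⟩; exact queryMinorityProb_nonneg A)

theorem minQueryProb_le {n : ℕ} {δ : ℝ} {A : RandTree (Leaf n)} (hA : A.Computes (maj3 n) δ) :
    minQueryProb δ n ≤ queryMinorityProb A :=
  csInf_le ⟨0, by rintro p ⟨A, -, rfl⟩; exact queryMinorityProb_nonneg A⟩ ⟨A, hA, rfl⟩

theorem le_minQueryProb {n : ℕ} {δ c : ℝ} (hδ : 0 ≤ δ)
    (h : ∀ A : RandTree (Leaf n), A.Computes (maj3 n) δ → c ≤ queryMinorityProb A) :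
    c ≤ minQueryProb δ n := by
  obtain ⟨A, hA⟩ := exists_computes (n := n) hδ
  exact le_csInf ⟨_, A, hA, rfl⟩ (by rintro p ⟨A, hA, rfl⟩; exact h A hA)

theorem minQueryProb_le_mul {Ω : Type} [Fintype Ω] [Nonempty Ω] {m n : ℕ}
    {f : Ω → Leaf n → Leaf m ⊕ Bool} (hf : IsCode f) {c : ℝ} (hc : 0 < c)
    (hd : Dominates f (minInd m) fun B x => c * minInd n B x) {δ : ℝ} (hδ : 0 ≤ δ) :
    minQueryProb δ m ≤ c * minQueryProb δ n := by
  rw [← div_le_iff₀' hc]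
  refine le_minQueryProb hδ fun A hA => ?_
  rw [div_le_iff₀' hc]
  have hb (B : DecTree (Leaf n)) (x : Input n) : |c * minInd n B x| ≤ c * 1 := by
    rw [abs_mul, abs_of_pos hc]
    exact mul_le_mul_of_nonneg_left (abs_minInd_le n B x) hc.le
  calc minQueryProb δ m = 𝔼 _ω : Ω, minQueryProb δ m := (Fintype.expect_const _).symm
    _ ≤ 𝔼 ω, average (minInd m) (PMF.map (DecTree.subst (f ω)) A) :=
      expect_le_expect fun ω _ => by
        rw [← queryMinorityProb_eq]
        exact minQueryProb_le (hA.map_subst (hf.maj3_app ω))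
    _ ≤ average (fun B x => c * minInd n B x) A := hd.average_le (abs_minInd_le m) hb A
    _ = c * queryMinorityProb A := by
      rw [queryMinorityProb_eq, average, average, mul_expect]
      simp only [RandTree.expect_const_mul]

/-- A tree that queries nothing errs on exactly one of the two inputs, so the indicator of querying
is at least 1 minus the two error indicators. -/
theorem one_sub_le_minQueryProb_zero {δ : ℝ} (hδ : 0 ≤ δ) : 1 - 2 * δ ≤ minQueryProb δ 0 := by
  refine le_minQueryProb hδ fun A hA => ?_
  rw [queryMinorityProb_eq, average]
  refine le_expect (hard_nonempty 0) fun x _ => ?_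
  have h0 := hA fun _ => false
  have h1 := hA fun _ => true
  rw [RandTree.prob_eq] at h0 h1
  have hs : (A.expect fun B => (1 - ind (B.eval (fun _ => false) ≠ maj3 0 fun _ => false)) -
      ind (B.eval (fun _ => true) ≠ maj3 0 fun _ => true)) ≤ A.expect fun B => minInd 0 B x := by
    refine A.expect_mono (C := 1 + 1 + 1) (D := 1) (fun B => ?_) (fun B => abs_minInd_le 0 B x)
      fun B => ?_
    · refine (abs_sub _ _).trans (add_le_add ((abs_sub _ _).trans (add_le_add ?_ ?_)) ?_)
      · simp
      · exact abs_ind_le _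
      · exact abs_ind_le _
    · cases B with
      | leaf b =>
        have := minInd_nonneg 0 (.leaf b) x
        cases b
        · rw [ind_false (by simp [DecTree.eval, maj3]), ind_true (by simp [DecTree.eval, maj3])]
          linarith
        · rw [ind_true (by simp [DecTree.eval, maj3]), ind_false (by simp [DecTree.eval, maj3])]
          linarith
      | node i t₀ t₁ =>
        have hm : minInd 0 (.node i t₀ t₁) x = 1 := ind_true (by
          rw [Subsingleton.elim (absMinority 0 x) i]; simp [DecTree.queried])
        rw [hm]
        have e0 := ind_nonneg ((DecTree.node i t₀ t₁).eval (fun _ => false) ≠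
          maj3 0 fun _ => false)
        have e1 := ind_nonneg ((DecTree.node i t₀ t₁).eval (fun _ => true) ≠
          maj3 0 fun _ => true)
        linarith
  rw [A.expect_sub (C := 1 + 1) (D := 1)
      (fun B => (abs_sub _ _).trans (add_le_add (by simp) (abs_ind_le _)))
      (fun B => abs_ind_le _),
    A.expect_sub (C := 1) (D := 1) (by simp) (fun B => abs_ind_le _), A.expect_one] at hs
  linarith

theorem minQueryProb_lower_bound {k : ℕ} (hk : 1 ≤ k) {δ : ℝ} (hδ : 0 ≤ δ) (h : ℕ) :
    (1 - 2 * δ) * (alpha k / 2 ^ k) * alpha k ^ (-((h : ℝ) / (k : ℝ))) ≤ minQueryProb δ h := by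
  have hα : 0 < alpha k := one_pos.trans_le (one_le_alpha k)
  have hk' : (0 : ℝ) < k := by exact_mod_cast hk
  -- For `δ ≥ 1/2` the bound is not positive and holds trivially.
  rcases le_total (1 - 2 * δ) 0 with hneg | hpos
  · refine le_trans ?_ (minQueryProb_nonneg δ h)
    rw [mul_assoc]
    exact mul_nonpos_of_nonpos_of_nonneg hneg (by positivity)
  have hsmall (h : ℕ) : (1 - 2 * δ) / 2 ^ h ≤ minQueryProb δ h := by
    induction h with
    | zero => simpa using one_sub_le_minQueryProb_zero hδ
    | succ h ih =>
      have h2 := minQueryProb_le_mul (isCode_bottomCode h) two_pos (dominates_bottomCode h) hδ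
      have h3 : (1 - 2 * δ) / 2 ^ h ≤ minQueryProb δ (h + 1) * 2 := by linarith
      rw [pow_succ, ← div_div]
      exact (div_le_iff₀ two_pos).2 h3
  induction h using Nat.strong_induction_on with
  | _ h ih =>
  rcases lt_or_ge h k with hlt | hge
  · refine le_trans ?_ (hsmall h)
    rw [mul_assoc, div_eq_mul_inv (1 - 2 * δ)]
    refine mul_le_mul_of_nonneg_left ?_ hpos
    have e1 : alpha k * alpha k ^ (-((h : ℝ) / k)) = alpha k ^ (((k - h : ℕ) : ℝ) / k) := by
      rw [Nat.cast_sub hlt.le, sub_div, div_self hk'.ne', Real.rpow_sub hα, Real.rpow_one,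
        Real.rpow_neg hα.le]
      rfl
    have e2 : alpha k ^ (((k - h : ℕ) : ℝ) / k) ≤ 2 ^ (k - h) := by
      calc alpha k ^ (((k - h : ℕ) : ℝ) / k) ≤ (2 ^ k : ℝ) ^ (((k - h : ℕ) : ℝ) / k) :=
            Real.rpow_le_rpow hα.le (alpha_le_two_pow k) (by positivity)
        _ = 2 ^ (k - h) := by
            rw [← Real.rpow_natCast 2 k, ← Real.rpow_mul zero_le_two,
              mul_div_cancel₀ _ hk'.ne', Real.rpow_natCast]
    rw [div_mul_eq_mul_div, e1, div_le_iff₀ (by positivity)]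
    refine e2.trans_eq ?_
    rw [eq_inv_mul_iff_mul_eq₀ (by positivity), ← pow_add, Nat.add_sub_cancel' hlt.le]
  · obtain ⟨h, rfl⟩ := Nat.exists_eq_add_of_le hge
    have hi := ih h (by omega)
    obtain ⟨Ω, _, _, f, hf, hd⟩ := exists_code_add k h
    have h1 := hi.trans (minQueryProb_le_mul hf hα hd hδ)
    rw [← div_le_iff₀' hα] at h1
    refine le_of_eq_of_le ?_ h1
    rw [Nat.cast_add, add_div, div_self hk'.ne', neg_add, Real.rpow_add hα, Real.rpow_neg_one]
    field_simp

/-! ## The expected number of queries -/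

theorem abs_countFrom_le (t n : ℕ) (B : DecTree (Leaf n)) (x : Input n) :
    |countFrom t n B x| ≤ 3 ^ t := by
  induction t generalizing n with
  | zero => rw [pow_zero]; exact abs_minInd_le n B x
  | succ t ih =>
    cases n with
    | zero => simp [countFrom]
    | succ n =>
      refine (abs_sum_le_sum_abs _ _).trans ((sum_le_sum fun a _ => ih _ _ _).trans ?_)
      simp [pow_succ, mul_comm]

theorem average_countFrom_lower_bound {δ c a : ℝ} (hp : ∀ s : ℕ, c * a ^ s ≤ minQueryProb δ s)
    (t n s : ℕ) (hn : n = s + t) (A : RandTree (Leaf n)) (hA : A.Computes (maj3 n) δ) :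
    c * a ^ s * (2 + a) ^ t ≤ average (countFrom t n) A := by
  induction t generalizing n s with
  | zero =>
    obtain rfl : n = s := hn
    rw [pow_zero, mul_one]
    refine (hp n).trans ((minQueryProb_le hA).trans_eq ?_)
    rw [queryMinorityProb_eq]
    rfl
  | succ t ih =>
    obtain ⟨n, rfl⟩ : ∃ n', n = n' + 1 := ⟨s + t, hn⟩
    obtain rfl : n = s + t := by omega
    obtain ⟨Ω, _, _, f, hf, hd⟩ := exists_code_count t (s + t) (by omega)
    have h1 := hd.average_le (C := 2 * 3 ^ t) (D := 3 ^ (t + 1) + 3 ^ t) (fun B y => by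
        rw [abs_mul, abs_two]
        exact mul_le_mul_of_nonneg_left (abs_countFrom_le t _ B y) zero_le_two)
      (fun B x => (abs_sub _ _).trans
        (add_le_add (abs_countFrom_le _ _ B x) (abs_countFrom_le _ _ B x))) A
    have h2 : average (fun B x => countFrom (t + 1) (s + t + 1) B x - countFrom t (s + t + 1) B x) A
        = average (countFrom (t + 1) (s + t + 1)) A - average (countFrom t (s + t + 1)) A := by
      simp only [average, ← expect_sub_distrib,
        A.expect_sub (fun B => abs_countFrom_le (t + 1) _ B _)
          (fun B => abs_countFrom_le t _ B _)]
    have h3 : 2 * (c * a ^ s * (2 + a) ^ t) ≤ 𝔼 ω,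
        average (fun B x => 2 * countFrom t (s + t) B x) (PMF.map (DecTree.subst (f ω)) A) := by
      refine le_expect univ_nonempty fun ω _ => ?_
      have := ih (s + t) s rfl _ (hA.map_subst (hf.maj3_app ω))
      simp only [average, RandTree.expect_const_mul, ← mul_expect] at this ⊢
      linarith
    have h4 := ih (s + t + 1) (s + 1) (by omega) A hA
    -- The two summands come from the code, at height `s + t`, and from the same tree with one more
    -- forced minority step.
    calc c * a ^ s * (2 + a) ^ (t + 1)
        = 2 * (c * a ^ s * (2 + a) ^ t) + c * a ^ (s + 1) * (2 + a) ^ t := by ring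
      _ ≤ _ := by linarith

/-- The worst-case cost is at least the average cost over hard inputs, and `countFrom h h` is the
number of queries. -/
theorem randComplexity_lower_bound {δ c a : ℝ} (hδ : 0 ≤ δ)
    (hp : ∀ s : ℕ, c * a ^ s ≤ minQueryProb δ s) (h : ℕ) :
    c * (2 + a) ^ h ≤ randComplexity δ (maj3 h) := by
  obtain ⟨A₀, hA₀⟩ := exists_computes (n := h) hδ
  refine le_csInf ⟨_, A₀, hA₀, rfl⟩ ?_
  rintro _ ⟨A, hA, rfl⟩
  have h1 := average_countFrom_lower_bound hp h h 0 (by omega) A hA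
  rw [pow_zero, mul_one] at h1
  refine h1.trans (expect_le (hard_nonempty h) fun x _ => ?_)
  simp only [countFrom_self]
  exact le_ciSup (f := fun x => A.cost x) (Set.finite_range _).bddAbove x

end RecMaj

theorem mainTheorem3 (k h : ℕ) (hk : 1 ≤ k) (δ : ℝ) (hδ : 0 ≤ δ) :
    RecMaj.minQueryProb δ h ≥
        (1 - 2 * δ) * (RecMaj.alpha k / 2 ^ k) * RecMaj.alpha k ^ (-((h : ℝ) / (k : ℝ))) ∧
    RecMaj.randComplexity δ (RecMaj.maj3 h) ≥
        (1 - 2 * δ) * (RecMaj.alpha k / 2 ^ k) *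
          (2 + RecMaj.alpha k ^ (-(1 / (k : ℝ)))) ^ h := by
  refine ⟨RecMaj.minQueryProb_lower_bound hk hδ h,
    RecMaj.randComplexity_lower_bound hδ (fun s => ?_) h⟩
  -- Here `a = α^(-1/k)` and `c = (1-2δ) α / 2^k`, so `a^s = α^(-s/k)`.
  refine le_of_eq_of_le ?_ (RecMaj.minQueryProb_lower_bound hk hδ s)
  rw [← Real.rpow_natCast (_ ^ (-(1 / (k : ℝ)))), ← Real.rpow_mul (zero_le_one.trans (RecMaj.one_le_alpha k))]
  congr 2
  ring
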